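/- **Harer–Zagier recurrence.** A rooted one-face map with $n\ge 1$ edges is encoded by a triple $(\alpha,\beta,\gamma)$ of permutations of the set $[2n]=\{1,\dots,2n\}$ of half-edges (the root being labelled $1$), where $\alpha$ is an involution without fixed points (its cycles are the edges), the cycles of $\beta$, fixed points included, are the vertices, and $\alpha\beta=\gamma=(1,2,\dots,2n)$ is the boundary of the unique face. Two such maps $(\alpha,\beta,\gamma)$ and $(\alpha',\beta',\gamma')$ are equivalent if there is a permutation $\pi$ of $[2n]$ with $\alpha'=\pi\alpha\pi^{-1}$, $\gamma'=\pi\gamma\pi^{-1}$ and $\pi(1)=1$. The genus $g$ of a map with $n$ edges and $v$ vertices is given by $v-n+1=2-2g$. For $n=0$ there is exactly one map, a single vertex, and it has genus $0$. Let $A(n,g)$ be the number of rooted one-face maps, up to equivalence, of genus $g$ with $n$ edges, and let $A(n,g)=0$ if $n<0$ or $g<0$. Then for all integers $n\ge 1$ and $g\ge 0$, $$(n+1)\,A(n,g)=2(2n-1)\,A(n-1,g)+(2n-1)(n-1)(2n-3)\,A(n-2,g-1).$$ -/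

import Mathlib

/-- A rooted one-face map (fatgraph with one boundary component) with `n` edges, encoded by a triple
of permutations of its `2n` half-edges. The half-edges are labelled along the boundary, starting
from the root; the labels `1, …, 2n` are here the elements `0, …, 2n - 1` of `Fin (2 * n)`, so the
root is `0`. The cycles of `α` are the edges, the cycles of `β` are the vertices, and `γ = αβ` is
the long cycle `(0 1 … 2n-1)`, the boundary of the unique face. -/
@[ext]
structure RootedOneFaceMap (n : ℕ) where
  α : Equiv.Perm (Fin (2 * n))
  β : Equiv.Perm (Fin (2 * n))
  γ : Equiv.Perm (Fin (2 * n))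
  α_involutive : ∀ i, α (α i) = i
  α_fixedPointFree : ∀ i, α i ≠ i
  γ_eq : γ = finRotate (2 * n)
  α_mul_β : α * β = γ

namespace RootedOneFaceMap

/-- The number of vertices: the number of cycles of `β`, fixed points included. The map without
edges consists of one isolated vertex, which carries no half-edge. -/
noncomputable def numVertices {n : ℕ} (M : RootedOneFaceMap n) : ℕ :=
  if n = 0 then 1 else Nat.card (Quotient (Equiv.Perm.SameCycle.setoid M.β))

/-- `M` has genus `g`: Euler's formula `v - n + 1 = 2 - 2g`. -/
def HasGenus {n : ℕ} (M : RootedOneFaceMap n) (g : ℕ) : Prop :=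
  (M.numVertices : ℤ) - (n : ℤ) + 1 = 2 - 2 * (g : ℤ)

/-- Two rooted one-face maps are equivalent if a relabelling `π` of the half-edges that fixes the
root carries one to the other. -/
def equivalence (n : ℕ) : Setoid (RootedOneFaceMap n) where
  r M M' := ∃ π : Equiv.Perm (Fin (2 * n)),
    M'.α = π * M.α * π⁻¹ ∧ M'.γ = π * M.γ * π⁻¹ ∧ ∀ i : Fin (2 * n), i.val = 0 → π i = i
  iseqv :=
    { refl := fun M => ⟨1, by simp, by simp, by simp⟩
      symm := by
        rintro M M' ⟨π, h1, h2, h3⟩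
        refine ⟨π⁻¹, ?_, ?_, fun i hi => ?_⟩
        · rw [h1]; group
        · rw [h2]; group
        · rw [Equiv.Perm.inv_eq_iff_eq, h3 i hi]
      trans := by
        rintro M M' M'' ⟨π, h1, h2, h3⟩ ⟨ρ, k1, k2, k3⟩
        refine ⟨ρ * π, ?_, ?_, fun i hi => ?_⟩
        · rw [k1, h1]; group
        · rw [k2, h2]; group
        · rw [Equiv.Perm.mul_apply, h3 i hi, k3 i hi] }

/-- The number of rooted one-face maps with `n` edges and genus `g`, up to equivalence. -/
noncomputable def count (n g : ℕ) : ℕ :=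
  Set.ncard (Quotient.mk (equivalence n) '' {M : RootedOneFaceMap n | M.HasGenus g})

end RootedOneFaceMap

/-- `A(n, g)`: the number of rooted one-face maps, up to equivalence, with `n` edges and genus `g`;
it is `0` if `n` or `g` is negative, as there are no such maps. -/
noncomputable def oneFaceMapNumber (n g : ℤ) : ℤ :=
  if 0 ≤ n ∧ 0 ≤ g then (RootedOneFaceMap.count n.toNat g.toNat : ℤ) else 0

/-! The proof counts maps with vertices colored from a set of N colors. Since β = αγ, the
N-colorings of the vertices are the functions f with f ∘ α ∘ γ = f, so the colored count is the
value at N of the polynomial ∑ N^v over all maps (`mapPoly`). It is shown to be (2n-1)!! times the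
coefficient of X^N in G_n = X(1+X)^n / (1-X)^(n+2) (`genFun`, `eval_mapPoly`).

By conjugation one may fix α and let γ run over all long cycles (`card_mul_sum_of_conj`). The
condition that γ is a long cycle is replaced by an alternating sum over γ-invariant sets A
(`sum_signedWeight`). For fixed f and A, the sum over γ then factors into a determinant on A and a
permanent on the complement (`sum_signedWeight_eq_det_mul_permanent`).

Summed over f, the contribution of A vanishes by antisymmetry as soon as two elements of A have
their partners outside A (`coloringSum_eq_zero`). The surviving sets are unions of pairs with at
most one extra element. The determinant forces f to be injective on A, giving a falling factorial of
N; the permanent gives a rising factorial. Each product of the two is a coefficient of a power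
series (`descFactorial_mul_ascFactorial`), and the binomial theorem sums them to G_n (`genFun_eq`).

Finally G_n satisfies a three-term recurrence in which X d/dX appears (`genFun_recurrence`). On
coefficients of X^N this operator is multiplication by N, so the relation becomes a recurrence for
`mapPoly`; comparing the coefficients at v = n+1-2g gives the theorem. -/

namespace HarerZagier

open Equiv Finset

/-! ### Detecting long cycles by signed invariant sets. -/

section IndicatorOfLongCycles

variable {V : Type*} [Fintype V] [DecidableEq V]

/-- For a `γ`-invariant set `A`, the sign of the number of cycles of `γ` in `A`;
for other sets, zero. -/
def signedWeight (γ : Perm V) (A : Finset V) : ℤ :=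
  if h : ∀ x, γ x ∈ A ↔ x ∈ A then (-1) ^ A.card * (Perm.sign (γ.subtypePerm h) : ℤ) else 0

/-- The elements of the cycle of `y`. -/
def orbitFinset (γ : Perm V) (y : V) : Finset V := univ.filter fun z => γ.SameCycle y z

lemma mem_orbitFinset {γ : Perm V} {y z : V} : z ∈ orbitFinset γ y ↔ γ.SameCycle y z := by
  simp [orbitFinset]

lemma apply_mem_orbitFinset (γ : Perm V) (y x : V) :
    γ x ∈ orbitFinset γ y ↔ x ∈ orbitFinset γ y := by
  simp [mem_orbitFinset]

/-- A cycle of length k has sign (-1)^(k-1), so each cycle contributes exactly one factor -1 to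
`signedWeight`. -/
lemma sign_cycleOf (γ : Perm V) (y : V) :
    (-1) ^ (orbitFinset γ y).card * (Perm.sign (γ.cycleOf y) : ℤ) = -1 := by
  by_cases hy : γ y = y
  · have h1 : orbitFinset γ y = {y} := by
      ext z
      rw [mem_orbitFinset, mem_singleton]
      exact ⟨fun h => (h.eq_of_left hy).symm, fun h => h ▸ Perm.SameCycle.refl _ _⟩
    rw [h1, (Perm.cycleOf_eq_one_iff γ).2 hy]
    simp
  · have h1 : orbitFinset γ y = (γ.cycleOf y).support := by
      ext z
      rw [mem_orbitFinset, Perm.mem_support_cycleOf_iff' hy]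
    rw [h1, (Perm.isCycle_cycleOf γ hy).sign]
    push_cast
    rw [mul_neg, ← mul_pow]
    simp

lemma signedWeight_union (γ : Perm V) (y : V) (A : Finset V)
    (hd : Disjoint A (orbitFinset γ y)) :
    signedWeight γ (A ∪ orbitFinset γ y) = -signedWeight γ A := by
  by_cases hA : ∀ x, γ x ∈ A ↔ x ∈ A
  · have hU : ∀ x, γ x ∈ A ∪ orbitFinset γ y ↔ x ∈ A ∪ orbitFinset γ y := fun x => by
      rw [mem_union, mem_union, hA, apply_mem_orbitFinset]
    rw [signedWeight, signedWeight, dif_pos hA, dif_pos hU, card_union_of_disjoint hd,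
      ← Perm.sign_ofSubtype, ← Perm.sign_ofSubtype (γ.subtypePerm hA)]
    have key : Perm.ofSubtype (γ.subtypePerm hU)
        = Perm.ofSubtype (γ.subtypePerm hA) * γ.cycleOf y := by
      ext x
      rw [Perm.mul_apply, Perm.cycleOf_apply]
      by_cases hx : γ.SameCycle y x
      · have h1 : x ∈ orbitFinset γ y := mem_orbitFinset.2 hx
        have h2 : γ x ∉ A := fun h => disjoint_left.1 hd h ((apply_mem_orbitFinset γ y x).2 h1)
        rw [if_pos hx, Perm.ofSubtype_apply_of_mem _ (mem_union_right _ h1),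
          Perm.ofSubtype_apply_of_not_mem _ h2]
        rfl
      · rw [if_neg hx]
        by_cases hxA : x ∈ A
        · rw [Perm.ofSubtype_apply_of_mem _ hxA, Perm.ofSubtype_apply_of_mem _ (mem_union_left _ hxA)]
          rfl
        · rw [Perm.ofSubtype_apply_of_not_mem _ hxA, Perm.ofSubtype_apply_of_not_mem]
          rw [mem_union, mem_orbitFinset]
          tauto
    rw [key, map_mul, pow_add]
    have := sign_cycleOf γ y
    push_cast
    linear_combination ((-1) ^ A.card * (Perm.sign (Perm.ofSubtype (γ.subtypePerm hA)) : ℤ)) * this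
  · have hU : ¬ ∀ x, γ x ∈ A ∪ orbitFinset γ y ↔ x ∈ A ∪ orbitFinset γ y := fun h => hA fun x => by
      have := h x
      rw [mem_union, mem_union] at this
      have h1 := apply_mem_orbitFinset γ y x
      have h2 := @disjoint_left _ _ _ |>.1 hd
      have h3 := @h2 x
      have h4 := @h2 (γ x)
      tauto
    rw [signedWeight, signedWeight, dif_neg hA, dif_neg hU, neg_zero]

/-- Toggling one whole cycle changes the number of cycles in an invariant set by one. This is the
sign-reversing involution behind the alternating sum. -/
lemma signedWeight_symmDiff (γ : Perm V) (y : V) (A : Finset V) :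
    signedWeight γ A + signedWeight γ (symmDiff A (orbitFinset γ y)) = 0 := by
  set C := orbitFinset γ y with hC
  by_cases hd : Disjoint A C
  · rw [hd.symmDiff_eq_sup, sup_eq_union, signedWeight_union γ y A hd, add_neg_cancel]
  by_cases hs : C ⊆ A
  · have h1 : A = symmDiff A C ∪ C := by
      rw [symmDiff_of_ge hs, sdiff_union_of_subset hs]
    have h2 : Disjoint (symmDiff A C) C := by
      rw [symmDiff_of_ge hs]; exact sdiff_disjoint
    conv_lhs => enter [1]; rw [h1]
    rw [signedWeight_union γ y _ h2, neg_add_cancel]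
  -- Here A cuts the cycle C properly, and so does the symmetric difference; neither is invariant
  -- and both weights vanish.
  · obtain ⟨a, haA, haC⟩ := not_disjoint_iff.1 hd
    obtain ⟨b, hbC, hbA⟩ := not_subset.1 hs
    have hab : γ.SameCycle a b := (mem_orbitFinset.1 haC).symm.trans (mem_orbitFinset.1 hbC)
    have hinv : ∀ D : Finset V, (∀ x, γ x ∈ D ↔ x ∈ D) → (a ∈ D ↔ b ∈ D) := by
      intro D hD
      obtain ⟨k, rfl⟩ := hab
      have : ((γ ^ k) a ∈ D ↔ a ∈ D) := by
        constructor
        · intro h1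
          have := ((γ.subtypePerm hD ^ (-k)) ⟨_, h1⟩).2
          rw [Perm.subtypePerm_zpow] at this
          simpa using this
        · intro h1
          have := ((γ.subtypePerm hD ^ k) ⟨_, h1⟩).2
          rw [Perm.subtypePerm_zpow] at this
          simpa using this
      exact this.symm
    rw [signedWeight, signedWeight, dif_neg, dif_neg, add_zero]
    · intro h
      have := hinv _ h
      simp only [mem_symmDiff] at this
      tauto
    · intro h
      have := hinv _ h
      tauto

/-- If γ is a single cycle, only the empty set is invariant and avoids x. Otherwise, toggling a
cycle that misses x cancels all terms. -/
lemma sum_signedWeight_of_notMem (γ : Perm V) (x : V) :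
    ∑ A : Finset V with x ∉ A, signedWeight γ A = if ∀ y, γ.SameCycle x y then 1 else 0 := by
  split_ifs with h
  · rw [sum_eq_single ∅]
    · rw [signedWeight, dif_pos (by simp),
        show γ.subtypePerm _ = 1 from Perm.ext fun a => absurd a.2 (notMem_empty _)]
      simp
    · intro A hA hne
      rw [signedWeight, dif_neg]
      intro hinv
      obtain ⟨a, ha⟩ := nonempty_iff_ne_empty.2 hne
      obtain ⟨k, hk⟩ := (h a).symm
      have := ((γ.subtypePerm hinv ^ k) ⟨_, ha⟩).2
      rw [Perm.subtypePerm_zpow] at this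
      simp [hk] at this
      simp at hA
      exact hA this
    · simp
  · push Not at h
    obtain ⟨y, hy⟩ := h
    have hx : x ∉ orbitFinset γ y := fun h => hy (mem_orbitFinset.1 h).symm
    have hyy : y ∈ orbitFinset γ y := mem_orbitFinset.2 (Perm.SameCycle.refl _ _)
    refine sum_involution (fun A _ => symmDiff A (orbitFinset γ y))
      (fun A _ => signedWeight_symmDiff γ y A) ?_ ?_ ?_
    · intro A _ _ h
      rw [symmDiff_eq_left] at h
      rw [h] at hyy
      simp at hyy
    · intro A hA
      simp only [mem_filter, mem_univ, true_and, mem_symmDiff] at hA ⊢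
      tauto
    · intro A _
      exact symmDiff_symmDiff_cancel_right _ _

/-- The alternating sum over invariant sets detects the permutations with a single cycle. -/
lemma sum_signedWeight (γ : Perm V) :
    ∑ A : Finset V, signedWeight γ A * ((Fintype.card V : ℤ) - A.card)
      = if ∀ x y, γ.SameCycle x y then (Fintype.card V : ℤ) else 0 := by
  -- The factor |V| - |A| counts the points x outside A. Averaging over x avoids a distinguished
  -- point, so that later weights depend on |A| only.
  have h1 : ∀ A : Finset V, signedWeight γ A * ((Fintype.card V : ℤ) - A.card)
      = ∑ x : V, if x ∉ A then signedWeight γ A else 0 := by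
    intro A
    rw [← sum_filter, sum_const, nsmul_eq_mul, mul_comm]
    congr 1
    rw [filter_not, filter_mem_eq_inter, univ_inter, ← compl_eq_univ_sdiff, card_compl,
      Nat.cast_sub (card_le_univ A)]
  simp_rw [h1]
  rw [sum_comm]
  simp_rw [← sum_filter, sum_signedWeight_of_notMem]
  split_ifs with h
  · simp [h]
  · apply sum_eq_zero
    intro x _
    rw [if_neg]
    exact fun hx => h fun a b => (hx a).symm.trans (hx b)

end IndicatorOfLongCycles

/-! ### Factorization into a determinant and a permanent. -/

section Factorization

variable {V W K : Type*} [Fintype V] [DecidableEq V] [Fintype W] [DecidableEq W] [DecidableEq K]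

/-- The zero-one matrix that records the coincidences of the values of `g` and `f`. -/
def matchMatrix (g f : W → K) : Matrix W W ℤ := .of fun i j => if g i = f j then 1 else 0

lemma det_matchMatrix (g f : W → K) :
    (matchMatrix g f).det = ∑ τ : Perm W, if ∀ i, g (τ i) = f i then (Perm.sign τ : ℤ) else 0 := by
  rw [Matrix.det_apply']
  refine sum_congr rfl fun τ _ => ?_
  simp only [matchMatrix, Matrix.of_apply, Fintype.prod_ite_zero]
  simp

lemma permanent_matchMatrix (g f : W → K) :
    (matchMatrix g f).permanent = ∑ τ : Perm W, if ∀ i, g (τ i) = f i then (1 : ℤ) else 0 := by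
  rw [Matrix.permanent]
  refine sum_congr rfl fun τ _ => ?_
  simp only [matchMatrix, Matrix.of_apply, Fintype.prod_ite_zero]
  simp

/-- A permutation preserving A is a pair of permutations, of A and of its complement. Only the first
carries a sign, whence a determinant and a permanent; the other permutations have weight zero. -/
lemma sum_signedWeight_eq_det_mul_permanent (g f : V → K) (A : Finset V) :
    ∑ γ : Perm V, (if ∀ i, g (γ i) = f i then signedWeight γ A else 0) =
      (-1) ^ A.card *
        ((matchMatrix (fun i : {x // x ∈ A} => g i) (fun i => f i)).det *
          (matchMatrix (fun i : {x // x ∉ A} => g i) (fun i => f i)).permanent) := by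
  rw [det_matchMatrix, permanent_matchMatrix, sum_mul_sum, ← Fintype.sum_prod_type', mul_sum]
  symm
  refine Fintype.sum_of_injective (Perm.subtypeCongrHom (· ∈ A))
    (Perm.subtypeCongrHom_injective _) _ _ ?_ ?_
  · intro γ hγ
    rw [ite_eq_right_iff]
    intro _
    rw [signedWeight, dif_neg]
    intro h
    refine hγ ⟨(γ.subtypePerm h, γ.subtypePerm fun x => not_congr (h x)), ?_⟩
    ext x
    by_cases hx : x ∈ A
    · exact Perm.subtypeCongr.left_apply _ _ hx
    · exact Perm.subtypeCongr.right_apply _ _ hx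
  · rintro ⟨τ, ρ⟩
    have hl : ∀ x (hx : x ∈ A), Perm.subtypeCongrHom (· ∈ A) (τ, ρ) x = τ ⟨x, hx⟩ :=
      fun x hx => Perm.subtypeCongr.left_apply _ _ hx
    have hr : ∀ x (hx : x ∉ A), Perm.subtypeCongrHom (· ∈ A) (τ, ρ) x = ρ ⟨x, hx⟩ :=
      fun x hx => Perm.subtypeCongr.right_apply _ _ hx
    set γ := Perm.subtypeCongrHom (· ∈ A) (τ, ρ)
    have hinv : ∀ x, γ x ∈ A ↔ x ∈ A := by
      intro x
      by_cases hx : x ∈ A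
      · simp [hl x hx, hx]
      · rw [hr x hx]
        exact iff_of_false (ρ ⟨x, hx⟩).2 hx
    have hτ : γ.subtypePerm hinv = τ := by
      ext x
      exact hl x x.2
    have hiff : (∀ i, g (γ i) = f i) ↔ (∀ i, g (τ i) = f i) ∧ ∀ i, g (ρ i) = f i := by
      constructor
      · exact fun h => ⟨fun i => by rw [← h i, hl i i.2], fun i => by rw [← h i, hr i i.2]⟩
      · rintro ⟨h1, h2⟩ i
        by_cases hi : i ∈ A
        · rw [hl i hi, h1]
        · rw [hr i hi, h2]
    rw [signedWeight, dif_pos hinv, hτ]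
    rw [if_congr hiff rfl rfl, ite_and]
    split_ifs <;> simp

end Factorization

/-! ### Sums over colorings: falling and rising factorials. -/

section ColorSums

variable {W K : Type*} [Fintype W] [DecidableEq W] [DecidableEq K]

lemma det_matchMatrix_eq_zero {f : W → K} (g : W → K) (hf : ¬ Function.Injective f) :
    (matchMatrix g f).det = 0 := by
  rw [Function.not_injective_iff] at hf
  obtain ⟨a, b, hab, hne⟩ := hf
  exact Matrix.det_zero_of_column_eq hne fun i => by simp [matchMatrix, hab]

lemma det_matchMatrix_self (f : W → K) :
    (matchMatrix f f).det = if Function.Injective f then 1 else 0 := by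
  split_ifs with hf
  · have : matchMatrix f f = 1 := by
      ext i j
      simp [matchMatrix, Matrix.one_apply, hf.eq_iff]
    rw [this, Matrix.det_one]
  · exact det_matchMatrix_eq_zero f hf

lemma det_matchMatrix_comp (σ : Perm W) (g f : W → K) :
    (matchMatrix (g ∘ σ) f).det = Perm.sign σ * (matchMatrix g f).det := by
  have h := Matrix.det_permute σ (matchMatrix g f)
  push_cast at h
  exact h

lemma permanent_matchMatrix_comp (σ : Perm W) (g f : W → K) :
    (matchMatrix (g ∘ σ) f).permanent = (matchMatrix g f).permanent := by
  rw [← Matrix.permanent_permute_cols σ (matchMatrix g f)]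
  rfl

lemma permanent_matchMatrix_comp_right (σ : Perm W) (g f : W → K) :
    (matchMatrix g (f ∘ σ)).permanent = (matchMatrix g f).permanent := by
  rw [← Matrix.permanent_permute_rows σ (matchMatrix g f)]
  rfl

variable [Fintype K]

lemma sum_injective :
    ∑ f : W → K, (if Function.Injective f then (1 : ℤ) else 0)
      = ((Fintype.card K).descFactorial (Fintype.card W) : ℤ) := by
  rw [← Fintype.card_embedding_eq, sum_boole, ← Fintype.card_subtype]
  congr 1
  exact Fintype.card_congr (Equiv.subtypeInjectiveEquivEmbedding W K)

/-- The permanent counts the color-preserving permutations, which permute each color class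
independently. -/
lemma permanent_matchMatrix_self (f : W → K) :
    (matchMatrix f f).permanent = ∏ k, ((Fintype.card {a // f a = k}).factorial : ℤ) := by
  rw [permanent_matchMatrix, sum_boole, ← Fintype.card_subtype, ← Nat.cast_prod,
    ← DomMulAct.stabilizer_card f]
  congr 1
  refine Fintype.card_congr (Equiv.subtypeEquivRight fun τ => ?_)
  rw [funext_iff]
  rfl

/-- Giving a new element the color c multiplies the product by one more than the size of the class
of c. Summed over c, these factors give |K| + m. -/
lemma sum_prod_factorial (m : ℕ) :
    ∑ f : Fin m → K, ∏ k, ((univ.filter fun a => f a = k).card.factorial : ℤ)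
      = ((Fintype.card K).ascFactorial m : ℤ) := by
  induction m with
  | zero => simp
  | succ m ih =>
    rw [← (Fin.consEquiv fun _ => K).sum_comp, Fintype.sum_prod_type_right, Nat.ascFactorial_succ,
      Nat.cast_mul, ← ih, mul_sum]
    refine sum_congr rfl fun f _ => ?_
    have h1 : ∀ c k : K, (univ.filter fun a => (Fin.consEquiv fun _ => K) (c, f) a = k).card
        = (if c = k then 1 else 0) + (univ.filter fun a => f a = k).card := by
      intro c k
      rw [Fin.card_filter_univ_succ']
      simp [Fin.consEquiv]
    simp_rw [h1]
    have h2 : ∀ c : K, ∏ k, (((if c = k then 1 else 0)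
        + (univ.filter fun a => f a = k).card).factorial : ℤ)
        = (((univ.filter fun a => f a = c).card : ℤ) + 1)
          * ∏ k, ((univ.filter fun a => f a = k).card.factorial : ℤ) := by
      intro c
      rw [← mul_prod_erase _ _ (mem_univ c), ← mul_prod_erase univ (fun k =>
        ((univ.filter fun a => f a = k).card.factorial : ℤ)) (mem_univ c), if_pos rfl, add_comm 1,
        Nat.factorial_succ, Nat.cast_mul, ← mul_assoc]
      push_cast
      congr 1
      refine prod_congr rfl fun k hk => ?_
      rw [if_neg (ne_of_mem_erase hk).symm, zero_add]
    simp_rw [h2]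
    rw [← sum_mul, sum_add_distrib]
    congr 1
    rw [← Nat.cast_sum, ← card_eq_sum_card_fiberwise (fun _ _ => mem_univ _)]
    simp [add_comm]

/-- Pairs of a coloring and a color-preserving permutation. -/
lemma sum_permanent_matchMatrix_self :
    ∑ f : W → K, (matchMatrix f f).permanent
      = ((Fintype.card K).ascFactorial (Fintype.card W) : ℤ) := by
  rw [← sum_prod_factorial, ← (Equiv.arrowCongr (Fintype.equivFin W).symm (Equiv.refl K)).sum_comp]
  refine sum_congr rfl fun f _ => ?_
  rw [permanent_matchMatrix_self]
  refine prod_congr rfl fun k _ => ?_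
  rw [← Fintype.card_subtype]
  congr 2
  exact Fintype.card_congr ((Fintype.equivFin W).subtypeEquiv fun a => by simp [Equiv.arrowCongr])

lemma matchMatrix_injective_comp {U C D : Type*} [DecidableEq C] [DecidableEq D] {e : C → D}
    (he : Function.Injective e) (g f : U → C) :
    matchMatrix (e ∘ g) (e ∘ f) = matchMatrix g f := by
  ext i j
  simp [matchMatrix, he.eq_iff]

/-- By symmetry, each color of a given element contributes the same share. -/
lemma card_mul_sum_permanent_of_apply_eq (b : W) (c : K) :
    (Fintype.card K : ℤ) * ∑ f : W → K, (if c = f b then (matchMatrix f f).permanent else 0)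
      = ((Fintype.card K).ascFactorial (Fintype.card W) : ℤ) := by
  have h : ∀ d : K, ∑ f : W → K, (if c = f b then (matchMatrix f f).permanent else 0)
      = ∑ f : W → K, if d = f b then (matchMatrix f f).permanent else 0 := by
    intro d
    rw [← ((Equiv.refl W).arrowCongr (Equiv.swap c d)).sum_comp]
    refine sum_congr rfl fun f _ => ?_
    have h1 : ((Equiv.refl W).arrowCongr (Equiv.swap c d)) f = Equiv.swap c d ∘ f := rfl
    rw [h1, matchMatrix_injective_comp (Equiv.injective _)]
    have h2 : c = (Equiv.swap c d ∘ f) b ↔ d = f b := by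
      rw [Function.comp_apply, eq_comm, Equiv.swap_apply_eq_iff, Equiv.swap_apply_left, eq_comm]
    simp only [h2]
  rw [← sum_permanent_matchMatrix_self, ← nsmul_eq_mul, ← card_univ, ← sum_const]
  rw [sum_congr rfl fun d _ => h d, sum_comm]
  simp

end ColorSums

/-! ### The contribution of a set A, summed over colorings. -/

section Involution

variable {V : Type*} [Fintype V] [DecidableEq V]

/-- The sum over all colorings of the contribution of the set `A` to the number of one-face
gluings. -/
def coloringSum (K : Type*) [Fintype K] [DecidableEq K] (α : Perm V) (A : Finset V) : ℤ :=
  ∑ f : V → K, (matchMatrix (fun i : {x // x ∈ A} => f (α i)) (fun i : {x // x ∈ A} => f i)).det *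
    (matchMatrix (fun i : {x // x ∉ A} => f (α i)) (fun i => f i)).permanent

variable {K : Type*} [Fintype K] [DecidableEq K]

/-- Exchanging the colors of α s and α t permutes the colorings. It swaps two rows of the
determinant and two columns of the permanent and leaves the rest alone, so the sum equals its own
negative. -/
lemma coloringSum_eq_zero {α : Perm V} {A : Finset V} {s t : V} (hst : s ≠ t)
    (hs : s ∈ A) (ht : t ∈ A) (hs' : α s ∉ A) (ht' : α t ∉ A) :
    coloringSum K α A = 0 := by
  have hneg : coloringSum K α A = -coloringSum K α A := by
    conv_lhs => rw [coloringSum]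
    rw [← ((swap (α s) (α t)).arrowCongr (Equiv.refl K)).sum_comp, coloringSum, ← sum_neg_distrib]
    refine sum_congr rfl fun f _ => ?_
    set f' := ((swap (α s) (α t)).arrowCongr (Equiv.refl K)) f
    have hf' : ∀ x, f' x = f (swap (α s) (α t) x) := fun x => rfl
    have e1 : (fun i : {x // x ∈ A} => f' (α i))
        = (fun i : {x // x ∈ A} => f (α i)) ∘ swap ⟨s, hs⟩ ⟨t, ht⟩ := by
      ext ⟨i, hi⟩
      simp only [hf', Function.comp_apply, swap_apply_def, EmbeddingLike.apply_eq_iff_eq,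
        Subtype.mk.injEq]
      split_ifs <;> rfl
    have e2 : (fun i : {x // x ∈ A} => f' i) = fun i : {x // x ∈ A} => f i := by
      ext ⟨i, hi⟩
      rw [hf', swap_apply_of_ne_of_ne]
      · rintro rfl; exact hs' hi
      · rintro rfl; exact ht' hi
    have e3 : (fun i : {x // x ∉ A} => f' (α i)) = fun i : {x // x ∉ A} => f (α i) := by
      ext ⟨i, hi⟩
      rw [hf', swap_apply_of_ne_of_ne]
      · rw [Ne, EmbeddingLike.apply_eq_iff_eq]; rintro rfl; exact hi hs
      · rw [Ne, EmbeddingLike.apply_eq_iff_eq]; rintro rfl; exact hi ht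
    have e4 : (fun i : {x // x ∉ A} => f' i)
        = (fun i : {x // x ∉ A} => f i) ∘ swap ⟨α s, hs'⟩ ⟨α t, ht'⟩ := by
      ext ⟨i, hi⟩
      simp only [hf', Function.comp_apply, swap_apply_def, Subtype.mk.injEq]
      split_ifs <;> rfl
    rw [e1, e2, e3, e4, det_matchMatrix_comp, permanent_matchMatrix_comp_right, Perm.sign_swap]
    · simp
    · simpa using hst
  linarith

lemma sum_eq_of_restrict {C : Type*} [Fintype C] (A : Finset V) (F : (V → C) → ℤ)
    (G : ({x // x ∈ A} → C) → ({x // x ∉ A} → C) → ℤ)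
    (h : ∀ f : V → C, F f = G (fun i => f i) (fun i => f i)) :
    ∑ f, F f = ∑ u, ∑ v, G u v := by
  rw [← Fintype.sum_prod_type', ← (Equiv.piEquivPiSubtypeProd (· ∈ A) fun _ => C).sum_comp]
  exact sum_congr rfl fun f _ => h f

lemma matchMatrix_subtypePerm {U C : Type*} [DecidableEq C] {p : U → Prop} (σ : Perm U)
    (h : ∀ x, p (σ x) ↔ p x) (f : U → C) :
    matchMatrix (fun i : {x // p x} => f (σ i)) (fun i => f i)
      = matchMatrix ((fun i : {x // p x} => f i) ∘ σ.subtypePerm h) (fun i => f i) := rfl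

/-- The colors on A and on its complement are independent. The determinant is a sign if f is
injective on A and zero otherwise; the permanent counts color-preserving permutations of the
complement. -/
lemma coloringSum_of_invariant {α : Perm V} {A : Finset V} (h : ∀ x, α x ∈ A ↔ x ∈ A) :
    coloringSum K α A = Perm.sign (α.subtypePerm h) *
      ((Fintype.card K).descFactorial A.card *
        (Fintype.card K).ascFactorial (Fintype.card V - A.card)) := by
  rw [coloringSum, sum_eq_of_restrict A _ (fun u v =>
    ((Perm.sign (α.subtypePerm h) : ℤ) * if Function.Injective u then 1 else 0) *
      (matchMatrix v v).permanent), ← sum_mul_sum, ← mul_sum, sum_injective,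
    sum_permanent_matchMatrix_self, mul_assoc, Fintype.card_coe, Fintype.card_subtype_compl,
    Fintype.card_coe]
  intro f
  rw [matchMatrix_subtypePerm (p := (· ∈ A)) α h,
    matchMatrix_subtypePerm (p := (· ∉ A)) α (fun x => not_congr (h x)),
    det_matchMatrix_comp, permanent_matchMatrix_comp, det_matchMatrix_self, mul_assoc]

/-- Only colorings with f s = f (α s) contribute, and for these α may be replaced by σ, which fixes
s and α s and preserves A. The two sides are then coupled only through the color of α s; by color
symmetry the factor |K| removes this coupling. -/
lemma card_mul_coloringSum_of_single {α : Perm V} {A : Finset V} {s : V} (hs : s ∈ A)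
    (hα : ∀ x, α (α x) = x) (hs' : α s ∉ A) (hA : ∀ x ∈ A, x ≠ s → α x ∈ A)
    (h : ∀ x, (α * swap s (α s)) x ∈ A ↔ x ∈ A) :
    (Fintype.card K : ℤ) * coloringSum K α A =
      Perm.sign ((α * swap s (α s)).subtypePerm h) *
      ((Fintype.card K).descFactorial A.card *
        (Fintype.card K).ascFactorial (Fintype.card V - A.card)) := by
  set σ := α * swap s (α s) with hσ
  have hσ_of_ne : ∀ x, x ≠ s → x ≠ α s → σ x = α x := fun x h1 h2 => by
    rw [hσ, Perm.mul_apply, swap_apply_of_ne_of_ne h1 h2]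
  have hσs : σ s = s := by rw [hσ, Perm.mul_apply, swap_apply_left, hα]
  have hσs' : σ (α s) = α s := by rw [hσ, Perm.mul_apply, swap_apply_right]
  have h1 : coloringSum K α A = ∑ u : {x // x ∈ A} → K, ∑ v : {x // x ∉ A} → K,
      ((Perm.sign (σ.subtypePerm h) : ℤ) * if Function.Injective u then 1 else 0) *
        if u ⟨s, hs⟩ = v ⟨α s, hs'⟩ then (matchMatrix v v).permanent else 0 := by
    refine sum_eq_of_restrict A _ _ ?_
    intro f
    change _ = _ * if f s = f (α s) then
      (matchMatrix (fun i : {x // x ∉ A} => f i) (fun i => f i)).permanent else 0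
    by_cases hf : f s = f (α s)
    · have hfσ : ∀ x, f (α x) = f (σ x) := by
        intro x
        by_cases h1 : x = s
        · rw [h1, hσs, hf]
        by_cases h2 : x = α s
        · rw [h2, hσs', hα, hf]
        rw [hσ_of_ne x h1 h2]
      rw [if_pos hf]
      simp only [hfσ]
      rw [matchMatrix_subtypePerm (p := (· ∈ A)) σ h,
        matchMatrix_subtypePerm (p := (· ∉ A)) σ (fun x => not_congr (h x)),
        det_matchMatrix_comp, permanent_matchMatrix_comp, det_matchMatrix_self]
    · rw [if_neg hf, mul_zero]
      refine mul_eq_zero_of_left ?_ _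
      by_cases hinj : Function.Injective fun i : {x // x ∈ A} => f i
      -- For injective f, an entry in column s could be nonzero only if α i = s with i in A, or if f
      -- (α s) = f s; both are excluded.
      · refine Matrix.det_eq_zero_of_column_eq_zero ⟨s, hs⟩ fun ⟨i, hi⟩ => ?_
        simp only [matchMatrix, Matrix.of_apply, ite_eq_right_iff, one_ne_zero, imp_false]
        by_cases h1 : i = s
        · subst h1
          exact fun h => hf h.symm
        · intro h2
          have h3 := @hinj ⟨α i, hA i hi h1⟩ ⟨s, hs⟩ h2
          simp only [Subtype.mk.injEq] at h3
          rw [← h3, hα] at hs'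
          exact hs' hi
      · exact det_matchMatrix_eq_zero _ hinj
  rw [h1]
  simp_rw [← mul_sum]
  have h2 : ∀ u : {x // x ∈ A} → K, (Fintype.card K : ℤ) *
      (((Perm.sign (σ.subtypePerm h) : ℤ) * if Function.Injective u then 1 else 0) *
        ∑ v : {x // x ∉ A} → K,
          if u ⟨s, hs⟩ = v ⟨α s, hs'⟩ then (matchMatrix v v).permanent else 0)
      = ((Perm.sign (σ.subtypePerm h) : ℤ) * if Function.Injective u then 1 else 0) *
        (Fintype.card K).ascFactorial (Fintype.card V - A.card) := by
    intro u
    rw [mul_left_comm, card_mul_sum_permanent_of_apply_eq, Fintype.card_subtype_compl,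
      Fintype.card_coe]
  rw [mul_sum, sum_congr rfl fun u _ => h2 u, ← sum_mul, ← mul_sum, sum_injective, Fintype.card_coe,
    mul_assoc]

end Involution

/-! ### The surviving sets for the standard pairing. -/

section Gluing

variable {ι : Type*}

/-- The standard fixed-point-free involution on pairs. -/
def flip (ι : Type*) : Perm (ι × Bool) := (Equiv.refl ι).prodCongr Equiv.boolNot

lemma flip_apply (x : ι × Bool) : flip ι x = (x.1, !x.2) := rfl

lemma flip_flip (x : ι × Bool) : flip ι (flip ι x) = x := by simp [flip_apply]

lemma flip_ne (x : ι × Bool) : flip ι x ≠ x := by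
  rw [flip_apply, Ne, Prod.ext_iff]; simp

/-- The union of a set of pairs. -/
def pairSet (J : Finset ι) : Finset (ι × Bool) := J ×ˢ univ

lemma mem_pairSet {J : Finset ι} {x : ι × Bool} : x ∈ pairSet J ↔ x.1 ∈ J := by simp [pairSet]

lemma card_pairSet (J : Finset ι) : (pairSet J).card = 2 * J.card := by
  simp [pairSet, mul_comm]

variable [DecidableEq ι]

/-- Subsets of `ι × Bool` that contain at most one element without its partner. -/
def nearPairSet : Finset ι ⊕ (Σ J : Finset ι, {s : ι × Bool // s.1 ∉ J}) → Finset (ι × Bool)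
  | .inl J => pairSet J
  | .inr x => insert x.2.1 (pairSet x.1)

/-- This recovers J from the set, as the indices both of whose elements are present; injectivity of
`nearPairSet` rests on it. -/
lemma mem_pairSet_of_mem {J : Finset ι} {s x : ι × Bool} (hx : x ∈ insert s (pairSet J))
    (hx' : flip ι x ∈ insert s (pairSet J)) : x.1 ∈ J := by
  rw [mem_insert, mem_pairSet] at hx hx'
  rcases hx with rfl | hx
  · rcases hx' with h | h
    · exact absurd h (flip_ne x)
    · exact h
  · exact hx

lemma nearPairSet_injective : Function.Injective (nearPairSet (ι := ι)) := by
  have hinr : ∀ (J : Finset ι) (s : ι × Bool) (hs : s.1 ∉ J) (J' : Finset ι)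
      (s' : ι × Bool), insert s (pairSet J) = insert s' (pairSet J') → J ⊆ J' := by
    intro J s hs J' s' h i hi
    have h1 : ∀ b, (i, b) ∈ insert s' (pairSet J') := fun b => by
      rw [← h]
      exact mem_insert_of_mem (mem_pairSet.2 hi)
    exact mem_pairSet_of_mem (h1 true) (h1 false)
  have hlr : ∀ (J J' : Finset ι) (s : ι × Bool) (_ : s.1 ∉ J'),
      pairSet J ≠ insert s (pairSet J') := by
    intro J J' s hs h
    have h1 : s ∈ pairSet J := by rw [h]; exact mem_insert_self _ _
    have h2 : flip ι s ∈ insert s (pairSet J') := by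
      rw [← h]; exact mem_pairSet.2 (show s.1 ∈ J from mem_pairSet.1 h1)
    exact hs (mem_pairSet_of_mem (mem_insert_self _ _) h2)
  rintro (J | ⟨J, s, hs⟩) (J' | ⟨J', s', hs'⟩) h
  · congr 1
    ext i
    have := congrArg ((i, true) ∈ ·) h
    simpa [nearPairSet, mem_pairSet] using this
  · exact absurd h (hlr _ _ _ hs')
  · exact absurd h.symm (hlr _ _ _ hs)
  · change insert s (pairSet J) = insert s' (pairSet J') at h
    obtain rfl : J = J' := (hinr _ _ hs _ _ h).antisymm (hinr _ _ hs' _ _ h.symm)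
    have : s ∈ insert s' (pairSet J) := h ▸ mem_insert_self _ _
    rw [mem_insert, mem_pairSet] at this
    obtain rfl := this.resolve_right hs
    rfl

variable [Fintype ι]

lemma sign_of_involution {W : Type*} [Fintype W] [DecidableEq W] {σ : Perm W}
    (h : ∀ x, σ (σ x) = x) {j k : ℕ} (hW : Fintype.card W = 2 * j + k)
    (hk : (univ.filter fun x => σ x = x).card = k) : Perm.sign σ = (-1) ^ j := by
  rw [Perm.sign_of_pow_two_eq_one (by ext x; simp [pow_two, h])]
  have : Fintype.card (Function.fixedPoints σ) = k := by
    rw [← hk, ← Fintype.card_subtype]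
    exact Fintype.card_congr (Equiv.refl _)
  rw [this, hW]
  congr 1
  omega

variable {K : Type*} [Fintype K] [DecidableEq K]

lemma coloringSum_pairSet (J : Finset ι) :
    coloringSum K (flip ι) (pairSet J) = (-1) ^ J.card *
      ((Fintype.card K).descFactorial (2 * J.card) *
        (Fintype.card K).ascFactorial (2 * Fintype.card ι - 2 * J.card)) := by
  have h : ∀ x, flip ι x ∈ pairSet J ↔ x ∈ pairSet J := fun x => by simp [mem_pairSet, flip_apply]
  rw [coloringSum_of_invariant h, card_pairSet,
    sign_of_involution (j := J.card) (k := 0) _ _ _]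
  · simp [mul_comm]
  · intro x
    ext1
    exact flip_flip x.1
  · simp [card_pairSet]
  · rw [card_eq_zero, filter_eq_empty_iff]
    intro x _ hx
    exact flip_ne x.1 (congrArg Subtype.val hx)

lemma card_mul_coloringSum_insert (J : Finset ι) {s : ι × Bool} (hs : s.1 ∉ J) :
    Fintype.card K * coloringSum K (flip ι) (insert s (pairSet J)) = (-1) ^ J.card *
      ((Fintype.card K).descFactorial (2 * J.card + 1) *
        (Fintype.card K).ascFactorial (2 * Fintype.card ι - (2 * J.card + 1))) := by
  set σ := flip ι * swap s (flip ι s) with hσ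
  have hσ_of_ne : ∀ x : ι × Bool, x.1 ≠ s.1 → σ x = flip ι x := fun x h1 => by
    rw [hσ, Perm.mul_apply, swap_apply_of_ne_of_ne]
    · rintro rfl; exact h1 rfl
    · rintro rfl; exact h1 rfl
  have hσs : σ s = s := by rw [hσ, Perm.mul_apply, swap_apply_left, flip_flip]
  have hσs' : σ (flip ι s) = flip ι s := by rw [hσ, Perm.mul_apply, swap_apply_right]
  have heq : ∀ x : ι × Bool, x.1 = s.1 → x = s ∨ x = flip ι s := by
    rintro ⟨i, a⟩ h
    obtain ⟨k, b⟩ := s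
    obtain rfl : i = k := h
    cases a <;> cases b <;> simp [flip_apply]
  have hcases : ∀ x : ι × Bool, (x.1 = s.1 ∧ σ x = x) ∨ (x.1 ≠ s.1 ∧ σ x = flip ι x) := by
    intro x
    by_cases hx : x.1 = s.1
    · refine Or.inl ⟨hx, ?_⟩
      obtain rfl | rfl := heq x hx
      · exact hσs
      · exact hσs'
    · exact Or.inr ⟨hx, hσ_of_ne x hx⟩
  have hmem : ∀ x : ι × Bool, x.1 ≠ s.1 → (x ∈ insert s (pairSet J) ↔ x.1 ∈ J) := by
    intro x hx
    rw [mem_insert, mem_pairSet, or_iff_right]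
    rintro rfl; exact hx rfl
  have h : ∀ x, σ x ∈ insert s (pairSet J) ↔ x ∈ insert s (pairSet J) := by
    intro x
    rcases hcases x with ⟨_, hx⟩ | ⟨hx, hx'⟩
    · rw [hx]
    · rw [hx', hmem x hx, hmem (flip ι x) (by exact hx)]
      rfl
  have hcard : (insert s (pairSet J)).card = 2 * J.card + 1 := by
    rw [card_insert_of_notMem (by rwa [mem_pairSet]), card_pairSet]
  rw [card_mul_coloringSum_of_single (mem_insert_self _ _) flip_flip _ _ h, hcard,
    sign_of_involution (j := J.card) (k := 1) _ _ _]
  · simp [mul_comm]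
  · intro x
    ext1
    change σ (σ x) = x
    rcases hcases x with ⟨_, hx⟩ | ⟨hx, hx'⟩
    · rw [hx, hx]
    · rw [hx', hσ_of_ne _ (by exact hx), flip_flip]
  · rw [Fintype.card_coe, hcard]
  · rw [card_eq_one]
    refine ⟨⟨s, mem_insert_self _ _⟩, ?_⟩
    ext ⟨x, hx⟩
    simp only [mem_filter, mem_univ, true_and, mem_singleton, Subtype.mk.injEq]
    constructor
    · intro hx'
      have hx' : σ x = x := congrArg Subtype.val hx'
      rcases mem_insert.1 hx with h1 | h1
      · exact h1
      · rcases hcases x with ⟨h2, _⟩ | ⟨_, h2⟩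
        · rw [mem_pairSet, h2] at h1
          exact absurd h1 hs
        · exact absurd (h2.symm.trans hx') (flip_ne x)
    · rintro rfl
      exact Subtype.ext hσs
  · rw [mem_insert, mem_pairSet]
    rintro (h | h)
    · exact flip_ne s h
    · exact hs h
  · intro x hx hne
    rw [mem_insert] at hx ⊢
    rw [mem_pairSet] at hx ⊢
    exact Or.inr (hx.resolve_left hne)

lemma mem_range_nearPairSet {A : Finset (ι × Bool)}
    (hA : ∀ s ∈ A, ∀ t ∈ A, flip ι s ∉ A → flip ι t ∉ A → s = t) :
    A ∈ Set.range (nearPairSet (ι := ι)) := by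
  set J : Finset ι := univ.filter fun i => ∀ b, (i, b) ∈ A with hJ
  have hmem : ∀ x : ι × Bool, x.1 ∈ J ↔ x ∈ A ∧ flip ι x ∈ A := by
    rintro ⟨i, b⟩
    rw [hJ, mem_filter]
    cases b <;> simp [flip_apply, and_comm]
  by_cases h : ∃ s ∈ A, flip ι s ∉ A
  · obtain ⟨s, hs, hs'⟩ := h
    refine ⟨.inr ⟨J, s, fun h => hs' ((hmem s).1 h).2⟩, ?_⟩
    ext x
    change x ∈ insert s (pairSet J) ↔ _
    rw [mem_insert, mem_pairSet, hmem]
    constructor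
    · rintro (rfl | h)
      · exact hs
      · exact h.1
    · intro hx
      by_cases hx' : flip ι x ∈ A
      · exact Or.inr ⟨hx, hx'⟩
      · exact Or.inl (hA x hx s hs hx' hs')
  · push Not at h
    refine ⟨.inl J, ?_⟩
    ext x
    change x ∈ pairSet J ↔ _
    rw [mem_pairSet, hmem]
    exact ⟨fun h => h.1, fun hx => ⟨hx, h x hx⟩⟩

/-- Only the sets with at most one unpaired element contribute. -/
lemma sum_coloringSum (c : ℕ → ℤ) :
    Fintype.card K * ∑ A : Finset (ι × Bool), c A.card * coloringSum K (flip ι) A =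
      ∑ j ∈ range (Fintype.card ι + 1), (Fintype.card ι).choose j * (-1) ^ j *
        (c (2 * j) * (Fintype.card K * ((Fintype.card K).descFactorial (2 * j) *
            (Fintype.card K).ascFactorial (2 * Fintype.card ι - 2 * j))) +
          c (2 * j + 1) * (2 * (Fintype.card ι - j) *
            ((Fintype.card K).descFactorial (2 * j + 1) *
              (Fintype.card K).ascFactorial (2 * Fintype.card ι - (2 * j + 1))))) := by
  rw [← Fintype.sum_of_injective nearPairSet nearPairSet_injective
    (fun x => c (nearPairSet x).card * coloringSum K (flip ι) (nearPairSet x)) _ _ fun _ => rfl]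
  · rw [Fintype.sum_sum_type, Fintype.sum_sigma, ← sum_add_distrib, mul_sum]
    set φ : ℕ → ℤ := fun j : ℕ => (-1) ^ j *
        (c (2 * j) * (Fintype.card K * ((Fintype.card K).descFactorial (2 * j) *
            (Fintype.card K).ascFactorial (2 * Fintype.card ι - 2 * j))) +
          c (2 * j + 1) * (2 * (Fintype.card ι - j) *
            ((Fintype.card K).descFactorial (2 * j + 1) *
              (Fintype.card K).ascFactorial (2 * Fintype.card ι - (2 * j + 1))))) with hφ
    have key : ∀ J : Finset ι, (Fintype.card K : ℤ) *
        (c (nearPairSet (.inl J)).card * coloringSum K (flip ι) (nearPairSet (.inl J)) +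
          ∑ s : {s : ι × Bool // s.1 ∉ J}, c (nearPairSet (.inr ⟨J, s⟩)).card *
            coloringSum K (flip ι) (nearPairSet (.inr ⟨J, s⟩))) =
        φ J.card := by
      intro J
      have h1 : ∀ s : {s : ι × Bool // s.1 ∉ J}, (Fintype.card K : ℤ) *
          (c (nearPairSet (.inr ⟨J, s⟩)).card *
            coloringSum K (flip ι) (nearPairSet (.inr ⟨J, s⟩))) =
          c (2 * J.card + 1) * ((-1) ^ J.card *
            ((Fintype.card K).descFactorial (2 * J.card + 1) *
            (Fintype.card K).ascFactorial (2 * Fintype.card ι - (2 * J.card + 1)))) := by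
        intro s
        change (Fintype.card K : ℤ) * (c (insert s.1 (pairSet J)).card *
            coloringSum K (flip ι) (insert s.1 (pairSet J))) = _
        rw [mul_left_comm, card_mul_coloringSum_insert J s.2,
          card_insert_of_notMem (by rw [mem_pairSet]; exact s.2), card_pairSet]
      -- The number of possible unpaired elements for a given J.
      have h2 : (Fintype.card {s : ι × Bool // s.1 ∉ J} : ℤ) = 2 * (Fintype.card ι - J.card) := by
        have e : {s : ι × Bool // s.1 ∉ J} ≃ {s : ι × Bool // ¬ s ∈ pairSet J} :=
          Equiv.subtypeEquivRight fun s => by rw [mem_pairSet]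
        rw [Fintype.card_congr e, Fintype.card_subtype_compl, Fintype.card_coe, card_pairSet,
          Nat.cast_sub]
        · simp; ring
        · have := card_le_univ J
          simp; omega
      rw [mul_add, mul_sum, sum_congr rfl fun s _ => h1 s, sum_const, card_univ, nsmul_eq_mul, h2]
      change (Fintype.card K : ℤ) * (c (pairSet J).card * coloringSum K (flip ι) (pairSet J)) + _ = _
      rw [coloringSum_pairSet, card_pairSet, hφ]
      ring
    rw [sum_congr rfl fun J _ => key J, ← powerset_univ, sum_powerset_apply_card, card_univ]
    refine sum_congr rfl fun j _ => ?_
    rw [nsmul_eq_mul, mul_assoc]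
  · intro A hA
    have : ∃ s ∈ A, ∃ t ∈ A, flip ι s ∉ A ∧ flip ι t ∉ A ∧ s ≠ t := by
      by_contra! h
      exact hA (mem_range_nearPairSet h)
    obtain ⟨s, hs, t, ht, hs', ht', hst⟩ := this
    rw [coloringSum_eq_zero hst hs ht hs' ht', mul_zero]

end Gluing

/-! ### Generating functions in the number of colors. -/

section PowerSeries

open PowerSeries

/-- Absorption, C(n,j)(n-j) = n C(n-1,j), reduces this to the binomial theorem. -/
lemma sum_choose_mul_sub {R : Type*} [CommRing R] (y : R) (n : ℕ) :
    ∑ j ∈ range (n + 1), (n.choose j : R) * ((n : R) - j) * y ^ j = n * (1 + y) ^ (n - 1) := by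
  rcases n with _ | n
  · simp
  rw [sum_range_succ]
  have h : ∀ j ∈ range (n + 1), ((n + 1).choose j : R) * (((n + 1 : ℕ) : R) - j) * y ^ j
      = ((n + 1 : ℕ) : R) * (y ^ j * 1 ^ (n - j) * (n.choose j)) := by
    intro j hj
    have h1 := congrArg (Nat.cast (R := R)) (Nat.choose_mul_succ_eq n j)
    rw [Nat.cast_mul, Nat.cast_mul, Nat.cast_sub (by simp at hj; omega)] at h1
    rw [← h1]
    ring
  rw [sum_congr rfl h, ← mul_sum, ← add_pow, add_comm y]
  simp

lemma sum_choose_mul_sub_mul_sub {R : Type*} [CommRing R] (y : R) (n : ℕ) :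
    ∑ j ∈ range (n + 1), (n.choose j : R) * (((n : R) - j) * ((n : R) - 1 - j)) * y ^ j
      = n * (n - 1) * (1 + y) ^ (n - 2) := by
  rcases n with _ | n
  · simp
  rw [sum_range_succ]
  have h : ∀ j ∈ range (n + 1), ((n + 1).choose j : R) *
      ((((n + 1 : ℕ) : R) - j) * (((n + 1 : ℕ) : R) - 1 - j)) * y ^ j
      = ((n + 1 : ℕ) : R) * ((n.choose j : R) * ((n : R) - j) * y ^ j) := by
    intro j hj
    have h1 := congrArg (Nat.cast (R := R)) (Nat.choose_mul_succ_eq n j)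
    rw [Nat.cast_mul, Nat.cast_mul, Nat.cast_sub (by simp at hj; omega)] at h1
    push_cast at h1 ⊢
    linear_combination (-((n : R) - j) * y ^ j) * h1
  rw [sum_congr rfl h, ← mul_sum, sum_choose_mul_sub]
  simp [mul_assoc]

/-- The geometric series. -/
noncomputable def geom : ℤ⟦X⟧ := mk 1

lemma geom_mul : geom * (1 - X) = 1 := mk_one_mul_one_sub_eq_one ℤ

lemma derivative_geom : derivative ℤ geom = geom ^ 2 := by
  have h := congrArg (derivative ℤ) geom_mul
  rw [Derivation.leibniz, map_sub, derivative_X] at h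
  simp only [Derivation.map_one_eq_zero, smul_eq_mul] at h
  linear_combination geom * h - (derivative ℤ geom) * geom_mul

lemma coeff_geom_pow (m d : ℕ) : coeff d (geom ^ (m + 1)) = ((m + d).choose m : ℤ) := by
  rw [geom, mk_one_pow_eq_mk_choose_add, coeff_mk]

/-- For a ≤ N the two factorials share the factor N. Without the duplicate they form the m
consecutive integers from N-a+1 to N+b-1, that is m! C(N-a+m, m). For a > N both sides vanish. -/
lemma descFactorial_mul_ascFactorial {N a b m : ℕ} (hN : N ≠ 0) (h : a + b = m + 1) :
    (N.descFactorial a * N.ascFactorial b : ℤ)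
      = N * m.factorial * coeff N (X ^ a * geom ^ (m + 1)) := by
  rw [coeff_X_pow_mul']
  split_ifs with ha
  · obtain ⟨d, rfl⟩ := Nat.exists_eq_add_of_le ha
    rw [Nat.add_sub_cancel_left, coeff_geom_pow]
    norm_cast
    apply Nat.eq_of_mul_eq_mul_left (Nat.factorial_pos d)
    obtain ⟨N, hN'⟩ := Nat.exists_eq_succ_of_ne_zero hN
    have h1 := Nat.factorial_mul_descFactorial ha
    have h2 := Nat.factorial_mul_ascFactorial N b
    have h3 := Nat.add_choose_mul_factorial_mul_factorial m d
    rw [← Nat.choose_symm_add] at h3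
    have h4 : m + d = N + b := by omega
    rw [Nat.add_sub_cancel_left] at h1
    rw [← mul_assoc, h1, hN', Nat.succ_eq_add_one, Nat.factorial_succ, mul_assoc, h2, ← h4, ← h3]
    ring
  · rw [Nat.descFactorial_eq_zero_iff_lt.2 (by omega)]
    simp

/-- The generating function in the number of colors. -/
noncomputable def genFun (n : ℕ) : ℤ⟦X⟧ := X * (1 + X) ^ n * geom ^ (n + 2)

lemma coeff_X_mul_derivative (f : ℤ⟦X⟧) (N : ℕ) :
    coeff N (X * derivative ℤ f) = N * coeff N f := by
  rcases N with _ | N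
  · simp
  · rw [coeff_succ_X_mul, coeff_derivative]
    push_cast
    ring

/-- Put u = (1+X)/(1-X). Then u' = 2/(1-X)^2, hence G_n = X u' u^n / 2, and u^2 - 1 = 2X u'.
Therefore u^(n+3) - u^(n+1) = 4 G_(n+1), and differentiating gives the recurrence. -/
lemma genFun_recurrence (n : ℕ) :
    ((n : ℤ⟦X⟧) + 3) * genFun (n + 2)
      = 2 * (X * derivative ℤ (genFun (n + 1))) + ((n : ℤ⟦X⟧) + 1) * genFun n := by
  have hD : derivative ℤ (genFun (n + 1)) = (1 + X) ^ (n + 1) * geom ^ (n + 3)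
      + ((n : ℤ⟦X⟧) + 1) * X * (1 + X) ^ n * geom ^ (n + 3)
      + ((n : ℤ⟦X⟧) + 3) * X * (1 + X) ^ (n + 1) * geom ^ (n + 4) := by
    rw [genFun]
    simp only [Derivation.leibniz, Derivation.leibniz_pow, derivative_geom, derivative_X, map_add,
      Derivation.map_one_eq_zero, smul_eq_mul, nsmul_eq_mul, Nat.add_sub_cancel]
    push_cast
    ring
  rw [hD, genFun, genFun]
  linear_combination ((X * (1 + X) ^ n * geom ^ (n + 2)) *
    (2 * (1 + X + ((n : ℤ⟦X⟧) + 1) * X) * geom + ((n : ℤ⟦X⟧) + 1) * (1 + geom * (1 - X)))) * geom_mul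

lemma genFun_one : genFun 1 = X * derivative ℤ (genFun 0) := by
  rw [genFun, genFun]
  simp only [Derivation.leibniz, Derivation.leibniz_pow, derivative_geom, derivative_X,
      smul_eq_mul, nsmul_eq_mul, pow_zero, mul_one]
  push_cast
  linear_combination (X * geom ^ 2) * geom_mul

/-- The left side is what the binomial sums leave, with multiplication by N written as X d/dX. It
simplifies because (1-X^2)/(1-X) = 1+X. -/
lemma genFun_eq (n : ℕ) :
    X * derivative ℤ ((1 - X ^ 2) ^ n * geom ^ (2 * (n + 1))) - X * geom ^ (2 * (n + 1)) *
      (2 * (n : ℤ⟦X⟧) * (1 - X ^ 2) ^ (n - 1) + (1 - X ^ 2) ^ n) = genFun (n + 1) := by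
  have hpow : ∀ k j : ℕ, (1 - X ^ 2 : ℤ⟦X⟧) ^ k * geom ^ (k + j) = (1 + X) ^ k * geom ^ j := by
    intro k j
    rw [pow_add, ← mul_assoc, ← mul_pow]
    congr 2
    linear_combination (1 + X) * geom_mul
  have h1 : (1 - X ^ 2 : ℤ⟦X⟧) ^ n * geom ^ (2 * (n + 1)) = (1 + X) ^ n * geom ^ (n + 2) := by
    rw [← hpow]
    congr 2
    ring
  rcases n with _ | n
  · rw [genFun]
    simp only [Derivation.leibniz, Derivation.leibniz_pow, derivative_geom, pow_zero,
      Derivation.map_one_eq_zero, smul_eq_mul, nsmul_eq_mul]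
    push_cast
    linear_combination (X * geom ^ 2) * geom_mul
  have h2 : (1 - X ^ 2 : ℤ⟦X⟧) ^ n * geom ^ (2 * (n + 1 + 1)) = (1 + X) ^ n * geom ^ (n + 4) := by
    rw [← hpow]
    congr 2
    ring
  have h3 : X * geom ^ (2 * (n + 1 + 1)) *
      (2 * ((n + 1 : ℕ) : ℤ⟦X⟧) * (1 - X ^ 2) ^ (n + 1 - 1) + (1 - X ^ 2) ^ (n + 1)) =
      X * (2 * ((n : ℤ⟦X⟧) + 1) * ((1 + X) ^ n * geom ^ (n + 4)) + (1 + X) ^ (n + 1) * geom ^ (n + 3)) := by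
    rw [← h2, ← h1]
    push_cast
    ring
  have hD : derivative ℤ ((1 + X) ^ (n + 1) * geom ^ (n + 1 + 2)) =
      ((n : ℤ⟦X⟧) + 1) * (1 + X) ^ n * geom ^ (n + 3) + ((n : ℤ⟦X⟧) + 3) * (1 + X) ^ (n + 1) * geom ^ (n + 4) := by
    simp only [Derivation.leibniz, Derivation.leibniz_pow, derivative_geom, derivative_X, map_add,
      Derivation.map_one_eq_zero, smul_eq_mul, nsmul_eq_mul, Nat.add_sub_cancel]
    push_cast
    ring
  rw [h3, h1, hD, genFun]
  linear_combination (-(X * (1 + X) ^ n * geom ^ (n + 3)) * (((n : ℤ⟦X⟧) + 1) - (1 + X))) * geom_mul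

end PowerSeries

/-! ### Colored gluings with a fixed pairing. -/

section LongCycles

variable {V : Type*} [Fintype V] [DecidableEq V]

/-- The number of colorings that are invariant under a permutation. -/
def invariantColorings (K : Type*) [Fintype K] [DecidableEq K] (σ : Perm V) : ℤ :=
  ∑ f : V → K, if ∀ i, f (σ i) = f i then 1 else 0

/-- Permutations with a single cycle. -/
def IsLongCycle (γ : Perm V) : Prop := ∀ x y, γ.SameCycle x y

instance : DecidablePred (IsLongCycle (V := V)) := fun γ =>
  inferInstanceAs (Decidable (∀ x y, γ.SameCycle x y))

variable {K : Type*} [Fintype K] [DecidableEq K]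

lemma card_mul_sum_longCycle (α : Perm V) :
    Fintype.card V * ∑ γ : Perm V with IsLongCycle γ, invariantColorings K (α * γ) =
      ∑ A : Finset V, ((-1) ^ A.card * ((Fintype.card V : ℤ) - A.card)) * coloringSum K α A := by
  have h1 : ∀ A : Finset V,
      ((-1) ^ A.card * ((Fintype.card V : ℤ) - A.card)) * coloringSum K α A =
      ∑ γ : Perm V, ∑ f : V → K, if ∀ i, f (α (γ i)) = f i then
        signedWeight γ A * ((Fintype.card V : ℤ) - A.card) else 0 := by
    intro A
    rw [coloringSum, mul_sum, sum_comm]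
    refine sum_congr rfl fun f _ => ?_
    rw [mul_right_comm, ← sum_signedWeight_eq_det_mul_permanent (fun i => f (α i)) f A, sum_mul]
    refine sum_congr rfl fun γ _ => ?_
    rw [ite_mul, zero_mul]
  rw [sum_congr rfl fun A _ => h1 A, sum_comm, mul_sum, sum_filter]
  refine sum_congr rfl fun γ _ => ?_
  rw [sum_comm, invariantColorings, mul_sum]
  have h2 := sum_signedWeight γ
  by_cases hγ : IsLongCycle γ
  · rw [if_pos hγ]
    rw [if_pos (show ∀ x y, γ.SameCycle x y from hγ)] at h2
    refine sum_congr rfl fun f _ => ?_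
    by_cases hf : ∀ i, f (α (γ i)) = f i
    · rw [if_pos (show ∀ i, f ((α * γ) i) = f i from hf)]
      simp only [if_pos hf]
      rw [h2, mul_one]
    · rw [if_neg (show ¬ ∀ i, f ((α * γ) i) = f i from hf)]
      simp only [if_neg hf]
      simp
  · rw [if_neg hγ]
    rw [if_neg (show ¬ ∀ x y, γ.SameCycle x y from hγ)] at h2
    refine (sum_eq_zero fun f _ => ?_).symm
    split_ifs
    · exact h2
    · simp

open PowerSeries in
/-- The number of colored one-face gluings, for a fixed pairing of the half-edges. -/
theorem sum_longCycle_flip {ι : Type*} [Fintype ι] [DecidableEq ι] {n : ℕ}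
    (hι : Fintype.card ι = n + 1) (hK : Fintype.card K ≠ 0) :
    ∑ γ : Perm (ι × Bool) with IsLongCycle γ, invariantColorings K (flip ι * γ) =
      (2 * n + 1).factorial * coeff (Fintype.card K) (genFun (n + 1)) := by
  set N := Fintype.card K with hN
  have h1 := card_mul_sum_longCycle (K := K) (flip ι)
  have h2 := sum_coloringSum (ι := ι) (K := K)
    fun k => (-1) ^ k * ((Fintype.card (ι × Bool) : ℤ) - k)
  rw [← h1, ← hN, hι] at h2
  have hV : (Fintype.card (ι × Bool) : ℤ) = 2 * (n + 1) := by
    rw [Fintype.card_prod, hι]; simp [mul_comm]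
  rw [hV] at h2
  -- With r = n+1-j, a union of j pairs has weight 2r. An extra element has 2r choices and weight
  -- 2r-1, and 2r(2r-1) = 4r(r-1) + 2r; this is the combination 4b + 2a below.
  set a : ℕ → ℤ := fun j => (n + 1).choose j * (((n + 1 : ℕ) : ℤ) - j) with ha
  set b : ℕ → ℤ := fun j =>
    (n + 1).choose j * ((((n + 1 : ℕ) : ℤ) - j) * (((n + 1 : ℕ) : ℤ) - 1 - j)) with hb
  have h3 : ∀ j ∈ range (n + 1 + 1), ((n + 1).choose j : ℤ) * (-1) ^ j *
        ((-1) ^ (2 * j) * (2 * ((n : ℤ) + 1) - ((2 * j : ℕ) : ℤ)) *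
            (N * (N.descFactorial (2 * j) * N.ascFactorial (2 * (n + 1) - 2 * j))) +
          (-1) ^ (2 * j + 1) * (2 * ((n : ℤ) + 1) - ((2 * j + 1 : ℕ) : ℤ)) *
            (2 * (((n + 1 : ℕ) : ℤ) - j) *
              (N.descFactorial (2 * j + 1) * N.ascFactorial (2 * (n + 1) - (2 * j + 1))))) =
      N * (2 * n + 1).factorial * coeff N ((2 * N * a j * (-1) ^ j) •
          (X ^ (2 * j) * geom ^ (2 * (n + 1)))
        - ((4 * b j + 2 * a j) * (-1) ^ j) • (X ^ (2 * j + 1) * geom ^ (2 * (n + 1)))) := by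
    intro j hj
    have e1 := descFactorial_mul_ascFactorial (N := N) (a := 2 * j) (b := 2 * (n + 1) - 2 * j)
      (m := 2 * n + 1) hK (by simp at hj; omega)
    have e2 : (((n + 1 : ℕ) : ℤ) - j) *
        (N.descFactorial (2 * j + 1) * N.ascFactorial (2 * (n + 1) - (2 * j + 1)))
        = (((n + 1 : ℕ) : ℤ) - j) * (N * (2 * n + 1).factorial *
          coeff N (X ^ (2 * j + 1) * geom ^ (2 * n + 1 + 1))) := by
      -- At j = n+1 the exponent 2(n+1) - (2j+1) is truncated to zero and the factorial identity
      -- does not apply, but the factor n+1-j vanishes.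
      rcases eq_or_ne j (n + 1) with rfl | hne
      · simp
      · rw [descFactorial_mul_ascFactorial hK (m := 2 * n + 1) (by simp at hj; omega)]
    rw [mul_assoc (2 : ℤ), e2, e1, map_sub, map_zsmul, map_zsmul, ha, hb, smul_eq_mul,
      smul_eq_mul, show 2 * n + 1 + 1 = 2 * (n + 1) by ring, pow_succ (-1 : ℤ), pow_mul]
    push_cast
    ring
  rw [sum_congr rfl h3, ← mul_sum, ← map_sum] at h2
  have h4 : ∑ j ∈ range (n + 1 + 1), ((2 * N * a j * (-1) ^ j) •
          (X ^ (2 * j) * geom ^ (2 * (n + 1)))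
        - ((4 * b j + 2 * a j) * (-1) ^ j) • (X ^ (2 * j + 1) * geom ^ (2 * (n + 1)))) =
      (2 * (n + 1) : ℤ) • ((N : ℤ) • ((1 - X ^ 2) ^ n * geom ^ (2 * (n + 1))) -
        X * geom ^ (2 * (n + 1)) *
          (2 * (n : ℤ⟦X⟧) * (1 - X ^ 2) ^ (n - 1) + (1 - X ^ 2) ^ n)) := by
    have s1 := sum_choose_mul_sub (-X ^ 2 : ℤ⟦X⟧) (n + 1)
    have s2 := sum_choose_mul_sub_mul_sub (-X ^ 2 : ℤ⟦X⟧) (n + 1)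
    rw [← sub_eq_add_neg] at s1 s2
    rw [Nat.add_sub_cancel] at s1
    rw [show n + 1 - 2 = n - 1 by omega] at s2
    have e : ∀ j ∈ range (n + 1 + 1), ((2 * N * a j * (-1) ^ j) •
          (X ^ (2 * j) * geom ^ (2 * (n + 1)))
        - ((4 * b j + 2 * a j) * (-1) ^ j) • (X ^ (2 * j + 1) * geom ^ (2 * (n + 1)))) =
        (2 * (N : ℤ⟦X⟧) * geom ^ (2 * (n + 1)) - 2 * X * geom ^ (2 * (n + 1))) *
          (((n + 1).choose j : ℤ⟦X⟧) * (((n + 1 : ℕ) : ℤ⟦X⟧) - (j : ℤ⟦X⟧)) * (-X ^ 2) ^ j) -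
        4 * X * geom ^ (2 * (n + 1)) * (((n + 1).choose j : ℤ⟦X⟧) * ((((n + 1 : ℕ) : ℤ⟦X⟧) - (j : ℤ⟦X⟧)) *
          (((n + 1 : ℕ) : ℤ⟦X⟧) - 1 - (j : ℤ⟦X⟧))) * (-X ^ 2) ^ j) := by
      intro j _
      rw [zsmul_eq_mul, zsmul_eq_mul, ha, hb, neg_pow (X ^ 2 : ℤ⟦X⟧), ← pow_mul]
      push_cast
      ring
    rw [sum_congr rfl e, sum_sub_distrib, ← mul_sum, ← mul_sum, s1, s2, zsmul_eq_mul, zsmul_eq_mul]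
    push_cast
    ring
  -- The factor N in front of a coefficient of X^N is absorbed as X d/dX.
  rw [h4, map_zsmul, map_sub, map_zsmul, smul_eq_mul, smul_eq_mul, ← coeff_X_mul_derivative,
    ← map_sub, genFun_eq] at h2
  have hN0 : (N : ℤ) ≠ 0 := by exact_mod_cast hK
  have hn0 : (2 * ((n : ℤ) + 1)) ≠ 0 := by positivity
  apply mul_left_cancel₀ hN0
  apply mul_left_cancel₀ hn0
  linear_combination h2

end LongCycles

/-! ### Exchanging the roles of pairing and long cycle. -/

section Conjugation

/-- Double counting of a conjugation-invariant function on the product of two classes. -/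
lemma card_mul_sum_of_conj {G : Type*} [Group G] [Fintype G] (P Q : G → Prop) [DecidablePred P]
    [DecidablePred Q] (h : G → G → ℤ) (hh : ∀ g a b, h (g * a * g⁻¹) (g * b * g⁻¹) = h a b)
    (hP : ∀ g a, P a → P (g * a * g⁻¹)) (hQ : ∀ g a, Q a → Q (g * a * g⁻¹))
    (hP' : ∀ a b, P a → P b → IsConj a b) (hQ' : ∀ a b, Q a → Q b → IsConj a b)
    {a₀ b₀ : G} (ha : P a₀) (hb : Q b₀) :
    ((univ.filter P).card : ℤ) * ∑ b with Q b, h a₀ b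
      = ((univ.filter Q).card : ℤ) * ∑ a with P a, h a b₀ := by
  have key : ∀ (R : G → Prop) [DecidablePred R], (∀ g a, R a → R (g * a * g⁻¹)) →
      ∀ (k : G → G → ℤ), (∀ g a b, k (g * a * g⁻¹) (g * b * g⁻¹) = k a b) →
      ∀ a a', IsConj a a' → ∑ b with R b, k a b = ∑ b with R b, k a' b := by
    intro R _ hR k hk a a' haa'
    obtain ⟨c, rfl⟩ := isConj_iff.1 haa'
    refine sum_nbij' (fun b => c * b * c⁻¹) (fun b => c⁻¹ * b * c) ?_ ?_ ?_ ?_ ?_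
    · intro b hb
      simp only [mem_filter, mem_univ, true_and] at hb ⊢
      exact hR c b hb
    · intro b hb
      simp only [mem_filter, mem_univ, true_and] at hb ⊢
      simpa using hR c⁻¹ b hb
    · intro b _; group
    · intro b _; group
    · intro b _; rw [hk]
  have e1 : ∑ a with P a, ∑ b with Q b, h a b
      = ((univ.filter P).card : ℤ) * ∑ b with Q b, h a₀ b := by
    rw [← nsmul_eq_mul, ← sum_const]
    refine sum_congr rfl fun a haP => ?_
    exact key Q hQ h hh _ _ (hP' _ _ (by simpa using haP) ha)
  have e2 : ∑ b with Q b, ∑ a with P a, h a b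
      = ((univ.filter Q).card : ℤ) * ∑ a with P a, h a b₀ := by
    rw [← nsmul_eq_mul, ← sum_const]
    refine sum_congr rfl fun b hbQ => ?_
    exact key P hP (fun b a => h a b) (fun g a b => hh g b a) _ _ (hQ' _ _ (by simpa using hbQ) hb)
  rw [← e1, ← e2, sum_comm]

variable {V : Type*} [Fintype V] [DecidableEq V]

/-- Fixed-point-free involutions. -/
def IsPairing (α : Perm V) : Prop := ∀ x, α (α x) = x ∧ α x ≠ x

instance : DecidablePred (IsPairing (V := V)) := fun α =>
  inferInstanceAs (Decidable (∀ x, α (α x) = x ∧ α x ≠ x))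

lemma isPairing_iff_cycleType {n : ℕ} (hV : Fintype.card V = 2 * n) (α : Perm V) :
    IsPairing α ↔ α.cycleType = Multiset.replicate n 2 := by
  constructor
  · intro h
    have h1 : α ^ 2 = 1 := by ext x; simp [pow_two, (h x).1]
    have h2 : α.support = univ := by
      ext x; simp [(h x).2]
    have h3 := Perm.cycleType_of_pow_prime_eq_one h1
    have h4 := α.sum_cycleType
    rw [h3, h2, card_univ, hV, Multiset.sum_replicate] at h4
    rw [h3]
    congr 1
    simp at h4
    omega
  · intro h
    have h1 : α ^ 2 = 1 := by
      rw [← orderOf_dvd_iff_pow_eq_one, ← Perm.lcm_cycleType, h]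
      exact Multiset.lcm_dvd.2 fun b hb => (Multiset.eq_of_mem_replicate hb).dvd
    have h2 : α.support = univ := by
      rw [← card_eq_iff_eq_univ, ← Perm.sum_cycleType, h, hV]
      simp [mul_comm]
    intro x
    have h3 := Perm.ext_iff.1 h1 x
    rw [pow_two] at h3
    refine ⟨h3, ?_⟩
    rw [← Perm.mem_support, h2]
    exact mem_univ x

lemma isLongCycle_iff_cycleType (hV : 2 ≤ Fintype.card V) (γ : Perm V) :
    IsLongCycle γ ↔ γ.cycleType = {Fintype.card V} := by
  have : Nontrivial V := Fintype.one_lt_card_iff_nontrivial.1 hV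
  constructor
  · intro h
    have h0 : ∀ x, γ x ≠ x := by
      intro x hx
      obtain ⟨y, hy⟩ := exists_ne x
      exact hy ((h x y).eq_of_left hx).symm
    obtain ⟨x⟩ : Nonempty V := inferInstance
    have h1 : γ.IsCycle := ⟨x, h0 x, fun y _ => h x y⟩
    rw [h1.cycleType]
    congr 1
    rw [card_eq_iff_eq_univ]
    ext x
    simp [h0 x]
  · intro h x y
    have h1 : γ.IsCycle := by
      rw [← Perm.card_cycleType_eq_one, h, Multiset.card_singleton]
    have h2 : γ.support = univ := by
      rw [← card_eq_iff_eq_univ, ← Perm.sum_cycleType, h, Multiset.sum_singleton]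
    refine h1.sameCycle ?_ ?_ <;> rw [← Perm.mem_support, h2] <;> exact mem_univ _

lemma card_longCycles (hV : 2 ≤ Fintype.card V) :
    (univ.filter (IsLongCycle (V := V))).card = (Fintype.card V - 1).factorial := by
  have h := Perm.card_of_cycleType_singleton (α := V) hV le_rfl
  rw [Nat.choose_self, mul_one] at h
  rw [← h]
  congr 1
  ext γ
  simp [isLongCycle_iff_cycleType hV]

lemma card_pairings {n : ℕ} (hV : Fintype.card V = 2 * n) :
    (univ.filter (IsPairing (V := V))).card * (2 ^ n * n.factorial) = (2 * n).factorial := by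
  have h := Perm.card_of_cycleType_mul_eq V (Multiset.replicate n 2)
  have h1 : univ.filter (IsPairing (V := V))
      = univ.filter fun g => g.cycleType = Multiset.replicate n 2 := by
    ext γ
    simp [isPairing_iff_cycleType hV]
  have h2 : ∏ k ∈ (Multiset.replicate n 2).toFinset, ((Multiset.replicate n 2).count k).factorial
      = n.factorial := by
    rcases n with _ | n
    · simp
    · rw [Multiset.toFinset_replicate, if_neg (by omega), prod_singleton,
        Multiset.count_replicate_self]
  rw [if_pos ⟨by simp [hV, mul_comm], fun a ha => (Multiset.eq_of_mem_replicate ha).ge⟩, h2, hV,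
    Multiset.sum_replicate, Multiset.prod_replicate] at h
  rw [h1, ← h]
  simp [mul_comm]

variable {K : Type*} [Fintype K] [DecidableEq K]

lemma invariantColorings_permCongr {W : Type*} [Fintype W] [DecidableEq W] (e : V ≃ W)
    (σ : Perm V) : invariantColorings K (e.permCongr σ) = invariantColorings K σ := by
  rw [invariantColorings, ← (e.arrowCongr (Equiv.refl K)).sum_comp, invariantColorings]
  refine sum_congr rfl fun f _ => ?_
  congr 1
  rw [← e.forall_congr_right]
  simp [Equiv.arrowCongr, Equiv.permCongr_apply]

lemma IsPairing.permCongr_iff {U W : Type*} (e : U ≃ W) (α : Perm U) :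
    IsPairing (e.permCongr α) ↔ IsPairing α := by
  rw [IsPairing, IsPairing, ← e.forall_congr_right]
  simp [Equiv.permCongr_apply]

lemma IsLongCycle.permCongr {U W : Type*} (e : U ≃ W) {γ : Perm U}
    (h : IsLongCycle γ) : IsLongCycle (e.permCongr γ) := by
  intro y z
  obtain ⟨k, hk⟩ := h (e.symm y) (e.symm z)
  refine ⟨k, ?_⟩
  have : e.permCongr γ ^ k = e.permCongr (γ ^ k) := (map_zpow e.permCongrHom γ k).symm
  rw [this, Equiv.permCongr_apply, hk, e.apply_symm_apply]

open PowerSeries in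
lemma sum_pairings_prod {ι : Type*} [Fintype ι] [DecidableEq ι] {n : ℕ}
    (hι : Fintype.card ι = n + 1) (hK : Fintype.card K ≠ 0) {γ : Perm (ι × Bool)}
    (hγ : IsLongCycle γ) :
    ∑ α : Perm (ι × Bool) with IsPairing α, invariantColorings K (α * γ) =
      (univ.filter (IsPairing (V := ι × Bool))).card *
        coeff (Fintype.card K) (genFun (n + 1)) := by
  have hV : Fintype.card (ι × Bool) = 2 * (n + 1) := by simp [hι, mul_comm]
  have h := card_mul_sum_of_conj (G := Perm (ι × Bool)) IsPairing IsLongCycle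
    (fun a b => invariantColorings K (a * b)) ?_ ?_ ?_ ?_ ?_
    (a₀ := flip ι) (b₀ := γ) (fun x => ⟨flip_flip x, flip_ne x⟩) hγ
  · rw [sum_longCycle_flip hι hK, card_longCycles (by omega), hV,
      show 2 * (n + 1) - 1 = 2 * n + 1 by omega] at h
    have h0 : ((2 * n + 1).factorial : ℤ) ≠ 0 := by exact_mod_cast Nat.factorial_ne_zero _
    apply mul_left_cancel₀ h0
    rw [← h]
    ring
  · intro g a b
    rw [← invariantColorings_permCongr g (a * b)]
    congr 1
    change g * a * g⁻¹ * (g * b * g⁻¹) = g * (a * b) * g⁻¹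
    group
  · exact fun g a ha => (IsPairing.permCongr_iff g a).2 ha
  · exact fun g a ha => ha.permCongr g
  · intro a b ha hb
    rw [Perm.isConj_iff_cycleType_eq, (isPairing_iff_cycleType hV a).1 ha,
      (isPairing_iff_cycleType hV b).1 hb]
  · intro a b ha hb
    rw [Perm.isConj_iff_cycleType_eq, (isLongCycle_iff_cycleType (by omega) a).1 ha,
      (isLongCycle_iff_cycleType (by omega) b).1 hb]

open PowerSeries in
/-- The number of colored pairings with a given single face. -/
theorem sum_pairings {n : ℕ} (hV : Fintype.card V = 2 * (n + 1)) (hK : Fintype.card K ≠ 0)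
    {γ : Perm V} (hγ : IsLongCycle γ) :
    ∑ α : Perm V with IsPairing α, invariantColorings K (α * γ) =
      (univ.filter (IsPairing (V := V))).card * coeff (Fintype.card K) (genFun (n + 1)) := by
  obtain ⟨e⟩ : Nonempty (V ≃ Fin (n + 1) × Bool) :=
    ⟨Fintype.equivOfCardEq (by simp [hV, mul_comm])⟩
  have hcard : (univ.filter (IsPairing (V := V))).card
      = (univ.filter (IsPairing (V := Fin (n + 1) × Bool))).card := by
    rw [← Fintype.card_subtype, ← Fintype.card_subtype]
    exact Fintype.card_congr
      (e.permCongr.subtypeEquiv fun α => (IsPairing.permCongr_iff e α).symm)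
  rw [hcard, ← sum_pairings_prod (by simp) hK (hγ.permCongr e), sum_filter, sum_filter,
    ← e.permCongr.sum_comp]
  refine sum_congr rfl fun α _ => ?_
  rw [← invariantColorings_permCongr e, if_congr (IsPairing.permCongr_iff e α) rfl rfl]
  congr 2
  exact map_mul e.permCongrHom α γ

end Conjugation

section Maps

/-- The map with a given pairing of its half-edges. -/
def mapOfPairing {n : ℕ} (α : Perm (Fin (2 * n))) (h : IsPairing α) : RootedOneFaceMap n where
  α := α
  β := α * finRotate (2 * n)
  γ := finRotate (2 * n)
  α_involutive i := (h i).1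
  α_fixedPointFree i := (h i).2
  γ_eq := rfl
  α_mul_β := by
    ext i
    simp [(h _).1]

lemma _root_.RootedOneFaceMap.β_eq {n : ℕ} (M : RootedOneFaceMap n) :
    M.β = M.α * finRotate (2 * n) := by
  rw [← M.γ_eq, ← M.α_mul_β, ← mul_assoc]
  have : M.α * M.α = 1 := by
    ext i
    simp [M.α_involutive]
  rw [this, one_mul]

/-- A rooted one-face map is determined by the pairing of its half-edges. -/
def mapEquivPairing (n : ℕ) : RootedOneFaceMap n ≃ {α : Perm (Fin (2 * n)) // IsPairing α} where
  toFun M := ⟨M.α, fun i => ⟨M.α_involutive i, M.α_fixedPointFree i⟩⟩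
  invFun α := mapOfPairing α.1 α.2
  left_inv M := by
    ext1
    · rfl
    · exact M.β_eq.symm
    · exact M.γ_eq.symm
  right_inv _ := rfl

instance (n : ℕ) : Fintype (RootedOneFaceMap n) := Fintype.ofEquiv _ (mapEquivPairing n).symm

lemma eq_one_of_commute_finRotate {m : ℕ} {π : Perm (Fin m)}
    (h : finRotate m = π * finRotate m * π⁻¹) (h0 : ∀ i : Fin m, i.val = 0 → π i = i) :
    π = 1 := by
  have hc : ∀ i, π (finRotate m i) = finRotate m (π i) := by
    intro i
    conv_rhs => rw [h]
    simp
  have key : ∀ k (hk : k < m), π ⟨k, hk⟩ = ⟨k, hk⟩ := by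
    intro k
    induction k with
    | zero => intro hk; exact h0 _ rfl
    | succ k ih =>
      intro hk
      obtain ⟨m, rfl⟩ : ∃ m', m = m' + 1 := ⟨m - 1, by omega⟩
      have h1 : finRotate (m + 1) ⟨k, by omega⟩ = ⟨k + 1, hk⟩ := finRotate_of_lt (by omega)
      have h2 := hc ⟨k, by omega⟩
      rwa [ih, h1] at h2
  ext1 i
  exact key i.1 i.2

/-- A rooted map has no nontrivial relabellings. -/
lemma eq_of_equivalence {n : ℕ} {M M' : RootedOneFaceMap n}
    (h : RootedOneFaceMap.equivalence n M M') : M = M' := by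
  obtain ⟨π, h1, h2, h3⟩ := h
  rw [M.γ_eq, M'.γ_eq] at h2
  rw [eq_one_of_commute_finRotate h2 h3] at h1
  apply (mapEquivPairing n).injective
  apply Subtype.ext
  change M.α = M'.α
  simpa using h1.symm

lemma count_eq (n g : ℕ) :
    RootedOneFaceMap.count n g =
      (univ.filter fun M : RootedOneFaceMap n => (M.numVertices : ℤ) = n + 1 - 2 * g).card := by
  rw [RootedOneFaceMap.count, Set.ncard_image_of_injective _
    fun M M' h => eq_of_equivalence (Quotient.exact h), ← Set.ncard_coe_finset]
  congr 1
  ext M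
  simp only [RootedOneFaceMap.HasGenus, Set.mem_ofPred_eq, coe_filter, mem_univ, true_and]
  constructor <;> intro h <;> linarith

open Polynomial

/-- The generating polynomial of rooted one-face maps by their number of vertices. -/
noncomputable def mapPoly (n : ℕ) : ℤ[X] := ∑ M : RootedOneFaceMap n, X ^ M.numVertices

lemma coeff_mapPoly (n k : ℕ) :
    (mapPoly n).coeff k = (univ.filter fun M : RootedOneFaceMap n => M.numVertices = k).card := by
  rw [mapPoly, finsetSum_coeff, ← sum_boole]
  refine sum_congr rfl fun M _ => ?_
  rw [coeff_X_pow]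
  simp [eq_comm]

lemma count_eq_coeff {n g k : ℕ} (h : k + 2 * g = n + 1) :
    (RootedOneFaceMap.count n g : ℤ) = (mapPoly n).coeff k := by
  rw [count_eq, coeff_mapPoly]
  congr 2
  ext M
  simp only [mem_filter, mem_univ, true_and]
  omega

lemma count_eq_zero {n g : ℕ} (h : n + 1 < 2 * g) : RootedOneFaceMap.count n g = 0 := by
  rw [count_eq, card_eq_zero, filter_eq_empty_iff]
  intro M _
  omega

lemma invariantColorings_eq {V : Type*} [Fintype V] [DecidableEq V] (σ : Perm V) (N : ℕ) :
    invariantColorings (Fin N) σ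
      = (N : ℤ) ^ Nat.card (Quotient (Perm.SameCycle.setoid σ)) := by
  have e : {f : V → Fin N // ∀ i, f (σ i) = f i} ≃
      (Quotient (Perm.SameCycle.setoid σ) → Fin N) :=
    { toFun := fun f => Quotient.lift f.1 (by
        rintro a b ⟨k, rfl⟩
        have h1 : Function.Semiconj f.1 σ id := f.2
        have h2 : ∀ (k : ℕ) x, f.1 ((σ ^ k) x) = f.1 x := by
          intro k
          induction k with
          | zero => simp
          | succ k ih => intro x; rw [pow_succ', Perm.mul_apply, f.2, ih]
        obtain ⟨k, rfl | rfl⟩ := k.eq_nat_or_neg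
        · rw [zpow_natCast, h2]
        · rw [← h2 k ((σ ^ (-(k : ℤ))) a)]
          simp)
      invFun := fun g => ⟨fun i => g ⟦i⟧, fun i => by
        refine congrArg g ?_
        exact Quotient.sound (s := Perm.SameCycle.setoid σ) (show σ.SameCycle (σ i) i from
          Perm.sameCycle_apply_left.2 (Perm.SameCycle.refl _ _))⟩
      left_inv := fun f => rfl
      right_inv := fun g => by
        ext q
        induction q using Quotient.inductionOn
        rfl }
  rw [invariantColorings, sum_boole, ← Fintype.card_subtype, ← Nat.card_eq_fintype_card,
    Nat.card_congr e, Nat.card_fun, Nat.card_eq_fintype_card, Fintype.card_fin]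
  push_cast
  rfl

lemma isLongCycle_finRotate (n : ℕ) : IsLongCycle (finRotate (n + 2)) := by
  rw [isLongCycle_iff_cycleType (by simp), cycleType_finRotate, Fintype.card_fin]

/-- The number of maps with `n` edges. -/
def numMaps (n : ℕ) : ℕ := (univ.filter (IsPairing (V := Fin (2 * n)))).card

lemma numMaps_succ (n : ℕ) : numMaps (n + 1) = (2 * n + 1) * numMaps n := by
  have h1 := card_pairings (V := Fin (2 * n)) (n := n) (by simp)
  have h2 := card_pairings (V := Fin (2 * (n + 1))) (n := n + 1) (by simp)
  rw [← numMaps] at h1 h2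
  rw [show 2 * (n + 1) = 2 * n + 1 + 1 by ring, Nat.factorial_succ (2 * n + 1),
    Nat.factorial_succ (2 * n), ← h1, Nat.factorial_succ n] at h2
  have h3 : 0 < 2 ^ (n + 1) * ((n + 1) * n.factorial) := by positivity
  apply Nat.eq_of_mul_eq_mul_right h3
  rw [h2]
  ring

lemma numMaps_zero : numMaps 0 = 1 := by
  have h := card_pairings (V := Fin (2 * 0)) (n := 0) (by simp)
  rw [numMaps]
  simpa only [pow_zero, mul_zero, Nat.factorial_zero, mul_one] using h

lemma sum_maps {R : Type*} [AddCommMonoid R] (n : ℕ) (F : Perm (Fin (2 * n)) → R) :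
    ∑ M : RootedOneFaceMap n, F M.α = ∑ α with IsPairing α, F α := by
  rw [← (mapEquivPairing n).symm.sum_comp, ← sum_subtype_eq_sum_filter, subtype_univ]
  rfl

lemma eval_mapPoly {n N : ℕ} (hN : N ≠ 0) :
    (mapPoly n).eval (N : ℤ) = numMaps n * PowerSeries.coeff N (genFun n) := by
  rcases n with _ | n
  · have h1 : ∀ M : RootedOneFaceMap 0, M.numVertices = 1 := fun M => by
      rw [RootedOneFaceMap.numVertices, if_pos rfl]
    have h2 := sum_maps 0 fun _ => (N : ℤ)
    rw [sum_const, sum_const, ← numMaps, numMaps_zero] at h2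
    obtain ⟨N, rfl⟩ := Nat.exists_eq_succ_of_ne_zero hN
    rw [mapPoly, eval_finsetSum, genFun, pow_zero, mul_one, Nat.succ_eq_add_one,
      PowerSeries.coeff_succ_X_mul, coeff_geom_pow]
    simp only [h1, pow_one, eval_X, sum_const, h2, numMaps_zero]
    simp [add_comm]
  · have h1 : ∀ M : RootedOneFaceMap (n + 1), ((X : ℤ[X]) ^ M.numVertices).eval (N : ℤ)
        = (fun α => invariantColorings (Fin N) (α * finRotate (2 * (n + 1)))) M.α := by
      intro M
      rw [RootedOneFaceMap.numVertices, if_neg (Nat.succ_ne_zero n), eval_pow, eval_X]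
      change _ = invariantColorings (Fin N) (M.α * finRotate (2 * (n + 1)))
      rw [← M.β_eq, invariantColorings_eq]
    rw [mapPoly, eval_finsetSum, sum_congr rfl fun M _ => h1 M,
      sum_maps (n + 1) fun α => invariantColorings (Fin N) (α * finRotate (2 * (n + 1))),
      sum_pairings (n := n) (by simp) (by simpa using hN) (γ := finRotate (2 * (n + 1)))
        (isLongCycle_finRotate (2 * n)),
      Fintype.card_fin, numMaps]

lemma poly_eq_of_eval {p q : ℤ[X]} (h : ∀ N : ℕ, N ≠ 0 → p.eval (N : ℤ) = q.eval (N : ℤ)) :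
    p = q := by
  refine eq_of_infinite_eval_eq p q (Set.infinite_of_injective_forall_mem
    (f := fun N : ℕ => ((N + 1 : ℕ) : ℤ)) (fun a b hab => ?_) fun N => h _ (Nat.succ_ne_zero N))
  simpa using hab

lemma mapPoly_zero : mapPoly 0 = X := by
  refine poly_eq_of_eval fun N hN => ?_
  obtain ⟨N, rfl⟩ := Nat.exists_eq_succ_of_ne_zero hN
  rw [eval_mapPoly hN, numMaps_zero, genFun, pow_zero, mul_one, Nat.succ_eq_add_one,
    PowerSeries.coeff_succ_X_mul, coeff_geom_pow]
  simp [add_comm]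

lemma mapPoly_one : mapPoly 1 = X * mapPoly 0 := by
  refine poly_eq_of_eval fun N hN => ?_
  rw [eval_mul, eval_X, eval_mapPoly hN, eval_mapPoly hN, genFun_one, coeff_X_mul_derivative,
    numMaps_succ, numMaps_zero]
  push_cast
  ring

lemma mapPoly_recurrence (n : ℕ) :
    C ((n : ℤ) + 3) * mapPoly (n + 2) = C (2 * (2 * (n : ℤ) + 3)) * (X * mapPoly (n + 1)) +
      C ((2 * (n : ℤ) + 3) * (n + 1) * (2 * n + 1)) * mapPoly n := by
  refine poly_eq_of_eval fun N hN => ?_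
  simp only [eval_add, eval_mul, eval_C, eval_X, eval_mapPoly hN]
  have h := congrArg (PowerSeries.coeff N) (genFun_recurrence n)
  rw [show ((n : PowerSeries ℤ) + 3) * genFun (n + 2) = (n + 3 : ℤ) • genFun (n + 2) by
      rw [zsmul_eq_mul]; push_cast; rfl,
    show (2 : PowerSeries ℤ) * (PowerSeries.X * PowerSeries.derivative ℤ (genFun (n + 1)))
      = (2 : ℤ) • (PowerSeries.X * PowerSeries.derivative ℤ (genFun (n + 1))) by
      rw [zsmul_eq_mul]; push_cast; rfl,
    show ((n : PowerSeries ℤ) + 1) * genFun n = (n + 1 : ℤ) • genFun n by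
      rw [zsmul_eq_mul]; push_cast; rfl,
    map_add, map_zsmul, map_zsmul, map_zsmul, coeff_X_mul_derivative] at h
  simp only [smul_eq_mul] at h
  rw [numMaps_succ (n + 1), numMaps_succ n]
  push_cast
  linear_combination (2 * (n + 1) + 1 : ℤ) * (2 * n + 1) * numMaps n * h

lemma coeff_mapPoly_eq_zero (n : ℕ) : ∀ k, n + 1 < k → (mapPoly n).coeff k = 0 := by
  induction n using Nat.twoStepInduction with
  | zero => intro k hk; rw [mapPoly_zero, coeff_X, if_neg (by omega)]
  | one =>
    intro k hk
    obtain ⟨k, rfl⟩ : ∃ j, k = j + 1 := ⟨k - 1, by omega⟩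
    rw [mapPoly_one, coeff_X_mul, mapPoly_zero, coeff_X, if_neg (by omega)]
  | more n ih0 ih1 =>
    intro k hk
    obtain ⟨k, rfl⟩ : ∃ j, k = j + 1 := ⟨k - 1, by omega⟩
    have h := congrArg (fun p => p.coeff (k + 1)) (mapPoly_recurrence n)
    simp only [coeff_add, coeff_C_mul, coeff_X_mul] at h
    rw [ih0 _ (by omega), ih1 _ (by omega)] at h
    have h1 : ((n : ℤ) + 3) ≠ 0 := by positivity
    simpa [h1] using h

/-- The coefficient of a polynomial at an integer, zero for negative integers. -/
noncomputable def intCoeff (p : ℤ[X]) (k : ℤ) : ℤ := if 0 ≤ k then p.coeff k.toNat else 0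

lemma intCoeff_X_mul (p : ℤ[X]) (k : ℤ) : intCoeff (X * p) k = intCoeff p (k - 1) := by
  rw [intCoeff, intCoeff]
  rcases lt_trichotomy k 0 with h | rfl | h
  · rw [if_neg (by omega), if_neg (by omega)]
  · simp
  · rw [if_pos (by omega), if_pos (by omega), show k.toNat = (k - 1).toNat + 1 by omega,
      coeff_X_mul]

lemma intCoeff_C_mul (p : ℤ[X]) (c k : ℤ) : intCoeff (C c * p) k = c * intCoeff p k := by
  rw [intCoeff, intCoeff, coeff_C_mul, mul_ite, mul_zero]

lemma intCoeff_add (p q : ℤ[X]) (k : ℤ) : intCoeff (p + q) k = intCoeff p k + intCoeff q k := by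
  rw [intCoeff, intCoeff, intCoeff, coeff_add]
  split_ifs <;> simp

lemma oneFaceMapNumber_eq (n : ℕ) (g : ℤ) :
    oneFaceMapNumber n g = intCoeff (mapPoly n) (n + 1 - 2 * g) := by
  rw [oneFaceMapNumber, intCoeff]
  by_cases hg : 0 ≤ g
  · obtain ⟨g, rfl⟩ := Int.eq_ofNat_of_zero_le hg
    rw [if_pos ⟨by omega, hg⟩, Int.toNat_natCast, Int.toNat_natCast]
    split_ifs with h
    · exact count_eq_coeff (by omega)
    · rw [count_eq_zero (by omega), Nat.cast_zero]
  · rw [if_neg (by omega), if_pos (by omega), coeff_mapPoly_eq_zero _ _ (by omega)]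

end Maps

end HarerZagier

open HarerZagier in
theorem mainTheorem6 (n g : ℤ) (hn : 1 ≤ n) (hg : 0 ≤ g) :
    (n + 1) * oneFaceMapNumber n g =
      2 * (2 * n - 1) * oneFaceMapNumber (n - 1) g +
        (2 * n - 1) * (n - 1) * (2 * n - 3) * oneFaceMapNumber (n - 2) (g - 1) := by
  obtain ⟨m, rfl⟩ : ∃ m : ℕ, n = m + 1 := ⟨(n - 1).toNat, by omega⟩
  rcases m with _ | m
  · have h0 := oneFaceMapNumber_eq 0 g
    have h1 := oneFaceMapNumber_eq 1 g
    rw [mapPoly_one, intCoeff_X_mul] at h1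
    push_cast at h0 h1 ⊢
    norm_num at h0 h1 ⊢
    rw [h1, h0]
    congr 1
    ring
  · have h := congrArg (intCoeff · ((m : ℤ) + 2 + 1 - 2 * g)) (mapPoly_recurrence m)
    simp only [intCoeff_add, intCoeff_C_mul, intCoeff_X_mul] at h
    have h0 := oneFaceMapNumber_eq m (g - 1)
    have h1 := oneFaceMapNumber_eq (m + 1) g
    have h2 := oneFaceMapNumber_eq (m + 2) g
    push_cast at h1 h2 ⊢
    rw [show (m : ℤ) + 1 - 2 * (g - 1) = m + 2 + 1 - 2 * g by ring] at h0
    rw [show (m : ℤ) + 1 + 1 - 2 * g = m + 2 + 1 - 2 * g - 1 by ring] at h1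
    rw [← h0, ← h1, ← h2] at h
    rw [show (m : ℤ) + 1 + 1 = m + 2 by ring, show (m : ℤ) + 2 - 1 = m + 1 by ring,
      show (m : ℤ) + 2 - 2 = m by ring]
    linear_combination h
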